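/- **Setting.** All functions are real-valued and live on $\mathbb R^+=[0,\infty)$ with Lebesgue measure $|\cdot|$. For $x\ge 0$ let $d_n(x)\in\{0,1\}$ ($n\in\mathbb Z$) be the binary digits, $x=\sum_n d_n(x)2^n$ (the terminating expansion for dyadic rationals). Put $d_n(x\oplus y)=d_n(x)+d_n(y) \bmod 2$, $d_n(x\otimes y)=\sum_m d_{n-m}(x)d_m(y)\bmod 2$, $e(x)=(-1)^{d_{-1}(x)}$, and let $\hat g(\xi)=\check g(\xi)=\int_{\mathbb R^+}e(\xi\otimes x)g(x)\,dx$ be the Walsh–Fourier transform and $\langle f,g\rangle=\int_{\mathbb R^+} fg$. A dyadic interval is $[n2^k,(n+1)2^k)\subset\mathbb R^+$ with $n,k\in\mathbb Z$. A tile (bitile) is a rectangle $I\times\omega$, with $I,\omega$ dyadic intervals, of area $1$ (respectively $2$). For a rectangle $P=I\times\omega$ write $I_P=I$, $\omega_P=\omega$. For a bitile $P$, the tiles $P_l,P_u$ are its lower and upper halves, i.e. $I_P$ times the lower, respectively upper, half of $\omega_P$. Tiles, and likewise bitiles, are partially ordered by $I_1\times\omega_1\le I_2\times\omega_2\iff \omega_2\subset\omega_1$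 and $I_1\subset I_2$. The wave packet of a tile is $\phi_{I\times\omega}(x)=|I|^{1/2}\,\check 1_\omega(x\oplus\inf I)$. If $S\subset\mathbb R^+\times\mathbb R^+$ is the disjoint union of a finite set $\mathbf p$ of tiles, put $\Pi_Sf=\sum_{p\in\mathbf p}\langle f,\phi_p\rangle\phi_p$ (this does not depend on $\mathbf p$). A finite set $\mathbf P$ of bitiles is convex if $P_1\le P_2\le P_3$ and $P_1,P_3\in\mathbf P$ imply $P_2\in\mathbf P$ for all bitiles $P_1,P_2,P_3$; it is $l$-convex if $P,P''\in\mathbf P$ and $P_l<P'_l<P''_l$ imply $P'\in\mathbf P$ for all bitiles $P,P',P''$. A tree is a finite set $T$ of bitiles together with a top frequency $\xi_T\in\mathbb R^+$ and a dyadic top interval $I_T$ such that $I_P\subset I_T$ and $\xi_T\in\omega_P$ for every $P\in T$. It is $l$-overlapping if $\xi_T\in\omega_{P_l}$ for every $P\in T$, and $u$-overlapping if $\xi_T\in\omega_{P_u}$ for every $P\in T$. For a convex tree $T$ put $\Pi_T=\Pi_{\bigcup_{P\in T}P}$, and for a finite convex set $\mathbf P$ of bitiles $$\mathrm{size}(\mathbf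 P,f)=\sup_{T}|I_T|^{-1/2}\|\Pi_Tf\|_{L^2},$$ where the supremum is over all convex trees $T\subset\mathbf P$. Finally, for $m:\mathbb R^+\to\mathbb R$, $$\|m\|_{V^r}=\|m\|_{L^\infty}+\sup_{N,\ \xi_0<\dots<\xi_N}\Big(\sum_{i=1}^N|m(\xi_i)-m(\xi_{i-1})|^r\Big)^{1/r}.$$ **Lemma.** Let $1<p<\infty$ and $2<r<\infty$. There is a constant $C_{p,r}$, depending only on $p$ and $r$, such that the following holds for every locally integrable $f:[0,\infty)\to\mathbb R$. Let $\overline T$ be a convex tree and let $T$ be a tree with $T\subset\overline T$ (as sets of bitiles) which is either $u$-overlapping, or both $l$-overlapping and $l$-convex. Then $$\Big\|\sum_{P\in T}\langle f,\phi_{P_l}\rangle\,\phi_{P_l}(x)\,1_{\omega_{P_u}}(\xi)\Big\|_{L^p_x(V^r_\xi)}\le C_{p,r}\,\mathrm{size}(\overline T,f)\,|I_{\overline T}|^{1/p}.$$ -/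

import Mathlib

open MeasureTheory Set
open scoped ENNReal NNReal

namespace WalshModel

noncomputable section

/-! ### Binary digits and the Walsh-Fourier transform on the half-line `[0, ∞)` -/

/-- Lebesgue measure on `ℝ⁺ = [0, ∞)`. Functions on `ℝ⁺` are functions on `ℝ` of which only the
values on `[0, ∞)` matter. -/
def halfLine : Measure ℝ := volume.restrict (Ici 0)

/-- `d_n(x)`, the digit with weight `2 ^ n` in the binary expansion of `x ≥ 0`; for dyadic rationals
this is the expansion that terminates. -/
def digit (n : ℤ) (x : ℝ) : ℕ := ⌊x / (2 : ℝ) ^ n⌋₊ % 2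

/-- `x ⊕ y`, bitwise addition without carry: the number with digits `d_n(x) + d_n(y) mod 2`. -/
def walshAdd (x y : ℝ) : ℝ :=
  ∑' n : ℤ, (((digit n x + digit n y) % 2 : ℕ) : ℝ) * (2 : ℝ) ^ n

/-- `d_n(x ⊗ y) = ∑_m d_{n-m}(x) d_m(y) mod 2`; the sum has only finitely many nonzero terms. -/
def mulDigit (n : ℤ) (x y : ℝ) : ℕ := (∑ᶠ m : ℤ, digit (n - m) x * digit m y) % 2

/-- `e(x ⊗ y)`, where `e(z) = exp (i π d_{-1}(z)) = (-1) ^ d_{-1}(z)`. -/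
def walshChar (x y : ℝ) : ℝ := (-1) ^ mulDigit (-1) x y

/-- The Walsh-Fourier transform `ξ ↦ ∫ e(ξ ⊗ x) g(x) dx` over `ℝ⁺`; it is its own inverse. -/
def walshTransform (g : ℝ → ℝ) (ξ : ℝ) : ℝ := ∫ x, walshChar ξ x * g x ∂halfLine

/-- The pairing `⟨f, g⟩ = ∫ f g` over `ℝ⁺` of real-valued functions. -/
def pairing (f g : ℝ → ℝ) : ℝ := ∫ x, f x * g x ∂halfLine

/-! ### Dyadic intervals, tiles and bitiles -/

/-- The dyadic interval `[index * 2 ^ scale, (index + 1) * 2 ^ scale)` contained in `ℝ⁺`. -/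
@[ext] structure DyadicInterval where
  scale : ℤ
  index : ℕ

namespace DyadicInterval

/-- The length `|I|`. -/
def length (I : DyadicInterval) : ℝ := (2 : ℝ) ^ I.scale

/-- The left endpoint `inf I`. -/
def left (I : DyadicInterval) : ℝ := I.index * I.length

/-- The interval as a set of points. -/
def toSet (I : DyadicInterval) : Set ℝ := Ico I.left (I.left + I.length)

/-- The lower (left) half of a dyadic interval. -/
def lowerHalf (I : DyadicInterval) : DyadicInterval := ⟨I.scale - 1, 2 * I.index⟩

/-- The upper (right) half of a dyadic interval. -/
def upperHalf (I : DyadicInterval) : DyadicInterval := ⟨I.scale - 1, 2 * I.index + 1⟩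

end DyadicInterval

/-- A tile: a dyadic rectangle `I × ω` of area `|I| |ω| = 2 ^ (I.scale + ω.scale) = 1`. -/
@[ext] structure Tile where
  time : DyadicInterval
  freq : DyadicInterval
  area : time.scale + freq.scale = 0

/-- A bitile: a dyadic rectangle `I × ω` of area `|I| |ω| = 2 ^ (I.scale + ω.scale) = 2`. -/
@[ext] structure Bitile where
  time : DyadicInterval
  freq : DyadicInterval
  area : time.scale + freq.scale = 1

/-- A tile as a subset of the phase plane. -/
def Tile.toSet (p : Tile) : Set (ℝ × ℝ) := p.time.toSet ×ˢ p.freq.toSet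

/-- A bitile as a subset of the phase plane. -/
def Bitile.toSet (P : Bitile) : Set (ℝ × ℝ) := P.time.toSet ×ˢ P.freq.toSet

/-- `P_l`, the lower half of a bitile. -/
def Bitile.lower (P : Bitile) : Tile where
  time := P.time
  freq := P.freq.lowerHalf
  area := by have := P.area; simp only [DyadicInterval.lowerHalf]; omega

/-- `P_u`, the upper half of a bitile. -/
def Bitile.upper (P : Bitile) : Tile where
  time := P.time
  freq := P.freq.upperHalf
  area := by have := P.area; simp only [DyadicInterval.upperHalf]; omega

/-- `I₁ × ω₁ ≤ I₂ × ω₂` if and only if `ω₂ ⊆ ω₁` and `I₁ ⊆ I₂`, for tiles. -/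
instance : Preorder Tile where
  le p q := q.freq.toSet ⊆ p.freq.toSet ∧ p.time.toSet ⊆ q.time.toSet
  le_refl _ := ⟨Subset.rfl, Subset.rfl⟩
  le_trans _ _ _ h h' := ⟨h'.1.trans h.1, h.2.trans h'.2⟩

/-- `I₁ × ω₁ ≤ I₂ × ω₂` if and only if `ω₂ ⊆ ω₁` and `I₁ ⊆ I₂`, for bitiles. -/
instance : Preorder Bitile where
  le P Q := Q.freq.toSet ⊆ P.freq.toSet ∧ P.time.toSet ⊆ Q.time.toSet
  le_refl _ := ⟨Subset.rfl, Subset.rfl⟩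
  le_trans _ _ _ h h' := ⟨h'.1.trans h.1, h.2.trans h'.2⟩

/-- Convexity of a finite set of bitiles. -/
def IsConvex (B : Finset Bitile) : Prop :=
  ∀ P₁ P₂ P₃ : Bitile, P₁ ∈ B → P₃ ∈ B → P₁ ≤ P₂ → P₂ ≤ P₃ → P₂ ∈ B

/-- `l`-convexity of a finite set of bitiles. -/
def IsLConvex (B : Finset Bitile) : Prop :=
  ∀ P P' P'' : Bitile, P ∈ B → P'' ∈ B → P.lower < P'.lower → P'.lower < P''.lower → P' ∈ B

/-! ### Wave packets and phase-plane projections -/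

/-- The `L²`-normalized Walsh wave packet `φ_{I × ω}(x) = |I|^{1/2} (1_ω)ˇ(x ⊕ inf I)`. -/
def wavePacket (p : Tile) (x : ℝ) : ℝ :=
  √p.time.length * walshTransform (p.freq.toSet.indicator 1) (walshAdd x p.time.left)

/-- `c` is a cover of `S` by pairwise disjoint tiles. -/
def IsTiling (c : Finset Tile) (S : Set (ℝ × ℝ)) : Prop :=
  (c : Set Tile).PairwiseDisjoint Tile.toSet ∧ ⋃ p ∈ c, p.toSet = S

open Classical in
/-- The phase-plane projection `Π_S f = ∑_p ⟨f, φ_p⟩ φ_p`, for a set `S` that is the disjoint union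
of finitely many tiles `p`; the result does not depend on the tiling. -/
def projection (S : Set (ℝ × ℝ)) (f : ℝ → ℝ) (x : ℝ) : ℝ :=
  if h : ∃ c : Finset Tile, IsTiling c S then
    ∑ p ∈ h.choose, pairing f (wavePacket p) * wavePacket p x
  else 0

/-! ### Trees and size -/

/-- A finite collection of bitiles together with a top frequency `ξ_T` and a top interval `I_T`
that form a tree. -/
structure Tree where
  bitiles : Finset Bitile
  topFreq : ℝ
  topTime : DyadicInterval
  time_subset : ∀ P ∈ bitiles, P.time.toSet ⊆ topTime.toSet
  freq_mem : ∀ P ∈ bitiles, topFreq ∈ P.freq.toSet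
  topFreq_nonneg : 0 ≤ topFreq

namespace Tree

/-- `ξ_T ∈ ω_{P_l}` for every bitile `P` of the tree. -/
def IsLOverlapping (T : Tree) : Prop := ∀ P ∈ T.bitiles, T.topFreq ∈ P.lower.freq.toSet

/-- `ξ_T ∈ ω_{P_u}` for every bitile `P` of the tree. -/
def IsUOverlapping (T : Tree) : Prop := ∀ P ∈ T.bitiles, T.topFreq ∈ P.upper.freq.toSet

/-- `Π_T`, the phase-plane projection to the union of the bitiles of the tree. -/
def proj (T : Tree) : (ℝ → ℝ) → ℝ → ℝ := projection (⋃ P ∈ T.bitiles, P.toSet)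

/-- `|I_T|` as an extended nonnegative number. -/
def topLength (T : Tree) : ℝ≥0∞ := ENNReal.ofReal T.topTime.length

end Tree

/-- `size(B, f) = sup_T |I_T|^{-1/2} ‖Π_T f‖_{L²}`, over all convex trees `T ⊆ B`. -/
def size (B : Finset Bitile) (f : ℝ → ℝ) : ℝ≥0∞ :=
  ⨆ (T : Tree) (_ : T.bitiles ⊆ B) (_ : IsConvex T.bitiles),
    T.topLength ^ (-(1 / 2) : ℝ) * eLpNorm (T.proj f) 2 halfLine

/-! ### Variation norm and model sum -/

/-- The `r`-variation norm of a function on `ℝ⁺`: its `L^∞` norm plus the supremum of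
`(∑_i |m(ξ_i) - m(ξ_{i-1})| ^ r) ^ (1/r)` over all finite sequences `ξ_0 < ⋯ < ξ_N` in `ℝ⁺`. -/
def variationNorm (r : ℝ) (m : ℝ → ℝ) : ℝ≥0∞ :=
  eLpNorm m ∞ halfLine +
    ⨆ (N : ℕ) (ξ : Fin (N + 1) → ℝ) (_ : StrictMono ξ) (_ : ∀ i, 0 ≤ ξ i),
      (∑ i : Fin N, ‖m (ξ i.succ) - m (ξ i.castSucc)‖ₑ ^ r) ^ (1 / r)

/-- `∑_{P ∈ B} ⟨f, φ_{P_l}⟩ φ_{P_l}(x) 1_{ω_{P_u}}(ξ)`. -/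
def modelSum (B : Finset Bitile) (f : ℝ → ℝ) (x ξ : ℝ) : ℝ :=
  ∑ P ∈ B, pairing f (wavePacket P.lower) * wavePacket P.lower x *
    P.upper.freq.toSet.indicator 1 ξ

end

end WalshModel

/-!
Everything is localized to the bitiles of `Tbar`, and the number `s` stands for an upper bound of
`size Tbar f`. The argument has three ingredients.

*Packing.* The squared inner product of two wave packets is the area of the intersection of their
tiles (`coef_packet_sq_eq_volume`). Hence, for every tiling of a region, the wave packet of a tile
inside the region satisfies Parseval's identity and lies in the span of the packets of the tiling,
and Bessel's inequality bounds the coefficients over disjoint tiles in the region by the norm of the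
projection (`sum_coef_sq_le`). The region of a convex tree does have a tiling (`exists_isTiling`).
So, if for each bitile through a fixed frequency `ξ` one takes the half that avoids `ξ`, the squared
coefficients over time intervals inside `J` add up to at most `s ^ 2 * |J|`
(`sum_coef_otherTile_sq_le`).

*A martingale.* After demodulation by `ξ`, the terms at those halves are the differences of a dyadic
martingale. If the tree is `u`-overlapping, the model sum at `x` is, as a function of the frequency,
a tail of this martingale along the dyadic intervals containing `x`, and the starting index of the
tail is monotone on both sides of `ξ` (`jump_bounds_uOverlapping`). If the tree is `l`-overlapping
and `l`-convex, the model sum takes the successive values of such a martingale on adjacent frequency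
intervals, and vanishes outside of them (`jump_bounds_lOverlapping`). In both cases the
`r`-variation in frequency is controlled by the numbers of jumps of the martingale of sizes `2 ^ (-j) * s`
(`variationNorm_le`).

*Counting jumps.* By the packing condition, the conditional second moment of the remaining
martingale is at most `s ^ 2`, and each jump of size `lam` uses up `lam ^ 2` of the second moment about the
current anchor. An induction over the dyadic tree turns this into exponential integrability of the
number of jumps, on the scale `(s / lam) ^ 2` (`lintegral_jumps_le`). This single estimate replaces
both Lépingle's inequality and the John-Nirenberg inequality, and gives all exponents `p` at once.
Summation over the levels `lam = 2 ^ (-j) * s` converges because `r > 2` (`levels_le`,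
`exists_eLpNorm_le`).
-/

namespace WalshModel

/-! ### Binary digits -/

/-- The index of the dyadic interval of length `2 ^ n` that contains `x ≥ 0`. -/
noncomputable def cell (n : ℤ) (x : ℝ) : ℕ := ⌊x / (2 : ℝ) ^ n⌋₊

/-- The dyadic interval of length `2 ^ n` that contains `x ≥ 0`. -/
noncomputable def dyad (n : ℤ) (x : ℝ) : DyadicInterval := ⟨n, cell n x⟩

lemma digit_eq_cell (n : ℤ) (x : ℝ) : digit n x = cell n x % 2 := rfl

lemma cell_add (n : ℤ) (j : ℕ) (x : ℝ) : cell (n + j) x = cell n x / 2 ^ j := by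
  unfold cell
  rw [zpow_add₀ two_ne_zero, zpow_natCast, ← div_div]
  have := Nat.floor_div_natCast (x / (2 : ℝ) ^ n) (2 ^ j)
  push_cast at this
  exact this

lemma cell_add_one (n : ℤ) (x : ℝ) : cell (n + 1) x = cell n x / 2 := by
  simpa using cell_add n 1 x

lemma cell_of_le {m n : ℤ} (h : m ≤ n) (x : ℝ) : cell n x = cell m x / 2 ^ (n - m).toNat := by
  rw [← cell_add]; congr 1; omega

lemma length_pos (I : DyadicInterval) : 0 < I.length := by
  unfold DyadicInterval.length; positivity

lemma left_nonneg (I : DyadicInterval) : 0 ≤ I.left :=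
  mul_nonneg (Nat.cast_nonneg _) (length_pos I).le

lemma mem_toSet {I : DyadicInterval} {x : ℝ} :
    x ∈ I.toSet ↔ 0 ≤ x ∧ cell I.scale x = I.index := by
  have hl := length_pos I
  have h0 : 0 ≤ I.left := left_nonneg I
  unfold DyadicInterval.toSet cell
  rw [mem_Ico]
  constructor
  · rintro ⟨h1, h2⟩
    have hx : 0 ≤ x := h0.trans h1
    refine ⟨hx, ?_⟩
    rw [Nat.floor_eq_iff (by positivity)]
    change _ ≤ x / I.length ∧ x / I.length < _
    rw [le_div_iff₀ hl, div_lt_iff₀ hl]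
    refine ⟨h1, ?_⟩
    calc x < I.left + I.length := h2
      _ = _ := by unfold DyadicInterval.left; ring
  · rintro ⟨hx, h⟩
    rw [Nat.floor_eq_iff (by positivity)] at h
    change _ ≤ x / I.length ∧ x / I.length < _ at h
    rw [le_div_iff₀ hl, div_lt_iff₀ hl] at h
    refine ⟨h.1, h.2.trans_eq ?_⟩
    unfold DyadicInterval.left; ring

lemma mem_dyad {n : ℤ} {x : ℝ} (hx : 0 ≤ x) : x ∈ (dyad n x).toSet := mem_toSet.2 ⟨hx, rfl⟩

lemma nonneg_of_mem {I : DyadicInterval} {x : ℝ} (h : x ∈ I.toSet) : 0 ≤ x := (mem_toSet.1 h).1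

lemma eq_dyad_of_mem {I : DyadicInterval} {x : ℝ} (h : x ∈ I.toSet) : I = dyad I.scale x := by
  ext
  · rfl
  · exact (mem_toSet.1 h).2.symm

lemma cell_left (I : DyadicInterval) {m : ℤ} (h : m ≤ I.scale) :
    cell m I.left = I.index * 2 ^ (I.scale - m).toNat := by
  unfold cell DyadicInterval.left DyadicInterval.length
  rw [mul_div_assoc, ← zpow_sub₀ two_ne_zero]
  obtain ⟨j, hj⟩ := Int.le.dest h
  have h1 : I.scale - m = (j : ℤ) := by omega
  rw [h1, zpow_natCast]
  simp only [Int.toNat_natCast]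
  exact_mod_cast Nat.floor_natCast (I.index * 2 ^ j)

lemma left_mem (I : DyadicInterval) : I.left ∈ I.toSet :=
  mem_toSet.2 ⟨left_nonneg I, by simp [cell_left I le_rfl]⟩

lemma cell_eq_zero {m : ℤ} {x : ℝ} (h : x < (2 : ℝ) ^ m) : cell m x = 0 := by
  unfold cell
  rw [Nat.floor_eq_zero, div_lt_one (by positivity)]
  exact h

lemma exists_lt_zpow (x : ℝ) : ∃ L : ℕ, x < (2 : ℝ) ^ (L : ℤ) := by
  obtain ⟨L, hL⟩ := pow_unbounded_of_one_lt x (one_lt_two)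
  exact ⟨L, by simpa using hL⟩

lemma cell_eq_zero_of_le {m n : ℤ} (hmn : m ≤ n) {x : ℝ} (h : x < (2 : ℝ) ^ m) : cell n x = 0 :=
  cell_eq_zero (h.trans_le (zpow_le_zpow_right₀ one_le_two hmn))

/-- A term of the binary expansion is the difference of two consecutive dyadic roundings, so that
the expansion telescopes. -/
lemma digit_mul_zpow (n : ℤ) (x : ℝ) : (digit n x : ℝ) * (2 : ℝ) ^ n
    = cell n x * (2 : ℝ) ^ n - cell (n + 1) x * (2 : ℝ) ^ (n + 1) := by
  rw [cell_add_one, digit_eq_cell, zpow_add₀ two_ne_zero]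
  have : (cell n x : ℝ) = (cell n x % 2 : ℕ) + 2 * (cell n x / 2 : ℕ) := by
    exact_mod_cast (Nat.mod_add_div _ 2).symm
  rw [zpow_one]
  linear_combination -(2 : ℝ) ^ n * this

lemma hasSum_digit {x : ℝ} (hx : 0 ≤ x) :
    HasSum (fun n : ℤ => (digit n x : ℝ) * (2 : ℝ) ^ n) x := by
  have key := fun n => digit_mul_zpow n x
  have h1 : HasSum (fun n : ℕ => (digit n x : ℝ) * (2 : ℝ) ^ (n : ℤ)) (cell 0 x) := by
    rw [hasSum_iff_tendsto_nat_of_nonneg (fun n => by positivity)]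
    have : ∀ N : ℕ, ∑ n ∈ Finset.range N, (digit n x : ℝ) * (2 : ℝ) ^ (n : ℤ)
        = cell 0 x - cell N x * (2 : ℝ) ^ (N : ℤ) := by
      intro N
      induction N with
      | zero => simp
      | succ N ih => rw [Finset.sum_range_succ, ih, key]; push_cast; ring
    simp_rw [this]
    obtain ⟨L, hL⟩ := exists_lt_zpow x
    refine tendsto_const_nhds.congr' ?_
    filter_upwards [Filter.eventually_ge_atTop L] with N hN
    rw [cell_eq_zero_of_le (m := L) (n := N) (by exact_mod_cast hN) hL]
    simp
  have h2 : HasSum (fun n : ℕ => (digit (-(n + 1 : ℤ)) x : ℝ) * (2 : ℝ) ^ (-(n + 1 : ℤ)))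
      (x - cell 0 x) := by
    rw [hasSum_iff_tendsto_nat_of_nonneg (fun n => by positivity)]
    have : ∀ N : ℕ, ∑ n ∈ Finset.range N, (digit (-(n + 1 : ℤ)) x : ℝ) * (2 : ℝ) ^ (-(n + 1 : ℤ))
        = cell (-N) x * (2 : ℝ) ^ (-N : ℤ) - cell 0 x := by
      intro N
      induction N with
      | zero => simp
      | succ N ih =>
        rw [Finset.sum_range_succ, ih, key]; push_cast
        rw [show -((N : ℤ) + 1) + 1 = -N by ring]; ring
    simp_rw [this]
    refine Filter.Tendsto.sub_const ?_ _
    rw [tendsto_iff_norm_sub_tendsto_zero]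
    refine squeeze_zero (fun _ => norm_nonneg _) (fun N => ?_)
      (tendsto_pow_atTop_nhds_zero_of_lt_one (r := (1 / 2 : ℝ)) (by norm_num) (by norm_num))
    have hp : (0 : ℝ) < (2 : ℝ) ^ (-N : ℤ) := by positivity
    have hc : (2 : ℝ) ^ (-N : ℤ) = (1 / 2) ^ N := by simp
    have hf := Nat.floor_le (a := x / (2 : ℝ) ^ (-N : ℤ)) (by positivity)
    have hf' := Nat.lt_floor_add_one (x / (2 : ℝ) ^ (-N : ℤ))
    rw [le_div_iff₀ hp] at hf
    rw [div_lt_iff₀ hp] at hf'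
    rw [Real.norm_eq_abs, abs_le, ← hc]
    unfold cell
    constructor <;> linarith
  have h3 := HasSum.of_nat_of_neg_add_one (f := fun n : ℤ => (digit n x : ℝ) * (2 : ℝ) ^ n) h1 h2
  rwa [add_sub_cancel] at h3

lemma measurable_cell (n : ℤ) : Measurable (cell n) :=
  Nat.measurable_floor.comp (measurable_id.div_const _)

lemma measurable_digit (n : ℤ) : Measurable (digit n) :=
  (measurable_of_countable (fun k : ℕ => k % 2)).comp (measurable_cell n)

lemma measurableSet_toSet (I : DyadicInterval) : MeasurableSet I.toSet := measurableSet_Ico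

/-- Subtracting the left endpoint of a dyadic interval does not change the finer digits. -/
lemma digit_sub_left {I : DyadicInterval} {x : ℝ} (hx : x ∈ I.toSet) {m : ℤ} (hm : m < I.scale) :
    digit m (x - I.left) = digit m x := by
  obtain ⟨j, hj⟩ := Int.le.dest (Int.add_one_le_iff.2 hm)
  have h1 : I.scale = m + (j + 1 : ℕ) := by push_cast; omega
  have h2 : x / (2 : ℝ) ^ m = (x - I.left) / (2 : ℝ) ^ m + (I.index * 2 ^ (j + 1) : ℕ) := by
    unfold DyadicInterval.left DyadicInterval.length
    rw [h1, zpow_add₀ two_ne_zero, zpow_natCast]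
    field_simp
    push_cast
    ring
  unfold digit
  rw [h2, Nat.floor_add_natCast (div_nonneg (sub_nonneg.2 hx.1) (by positivity))]
  have : I.index * 2 ^ (j + 1) = 2 * (I.index * 2 ^ j) := by ring
  omega

lemma digit_left_of_lt {I : DyadicInterval} {m : ℤ} (hm : m < I.scale) : digit m I.left = 0 := by
  rw [digit_eq_cell, cell_left I hm.le]
  obtain ⟨j, hj⟩ := Int.le.dest (Int.add_one_le_iff.2 hm)
  have h1 : (I.scale - m).toNat = j + 1 := by omega
  rw [h1, pow_succ, ← mul_assoc]
  omega

lemma digit_eq_of_mem {I : DyadicInterval} {x y : ℝ} (hx : x ∈ I.toSet) (hy : y ∈ I.toSet) {m : ℤ}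
    (hm : I.scale ≤ m) : digit m x = digit m y := by
  rw [digit_eq_cell, digit_eq_cell, cell_of_le hm, cell_of_le hm, (mem_toSet.1 hx).2,
    (mem_toSet.1 hy).2]

lemma walshAdd_left_of_mem {I : DyadicInterval} {x : ℝ} (hx : x ∈ I.toSet) :
    walshAdd x I.left = x - I.left := by
  rw [← ((hasSum_digit (nonneg_of_mem hx)).sub (hasSum_digit (left_nonneg I))).tsum_eq]
  unfold walshAdd
  refine tsum_congr fun n => ?_
  rcases lt_or_ge n I.scale with h | h
  · rw [digit_left_of_lt h]; simp [digit]
  · rw [digit_eq_of_mem hx (left_mem I) h, ← sub_mul, sub_self, ← two_mul]; simp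

lemma digit_le_one (n : ℤ) (x : ℝ) : digit n x ≤ 1 := by unfold digit; omega

/-- Two points `x, y ≥ 0` with the same digits from the index `k` on lie in the same dyadic interval
of length `2 ^ k`. -/
lemma cell_eq_of_digit_eq {k : ℤ} {x y : ℝ} (h : ∀ n, k ≤ n → digit n x = digit n y) :
    cell k x = cell k y := by
  obtain ⟨L, hL⟩ := exists_lt_zpow x
  obtain ⟨L', hL'⟩ := exists_lt_zpow y
  have H : ∀ j : ℕ, ∀ n, k ≤ n → max L L' ≤ n + j → cell n x = cell n y := by
    intro j
    induction j with
    | zero =>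
      intro n _ hn
      rw [cell_eq_zero_of_le (by omega) hL, cell_eq_zero_of_le (by omega) hL']
    | succ j ih =>
      intro n hk hn
      have h1 := ih (n + 1) (by omega) (by push_cast at hn; omega)
      rw [cell_add_one, cell_add_one] at h1
      have h2 := h n hk
      rw [digit_eq_cell, digit_eq_cell] at h2
      omega
  exact H (max L L' - k).toNat k le_rfl (by omega)

lemma le_walshAdd_left {I : DyadicInterval} {x : ℝ} (hx0 : 0 ≤ x) (hx : x ∉ I.toSet) :
    I.length ≤ walshAdd x I.left := by
  have h1 : ∃ n, I.scale ≤ n ∧ digit n x ≠ digit n I.left := by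
    by_contra! hcon
    refine hx (mem_toSet.2 ⟨hx0, ?_⟩)
    rw [cell_eq_of_digit_eq hcon, (mem_toSet.1 (left_mem I)).2]
  obtain ⟨n, hn, hne⟩ := h1
  have hs : Summable fun n : ℤ => (((digit n x + digit n I.left) % 2 : ℕ) : ℝ) * (2 : ℝ) ^ n := by
    refine Summable.of_nonneg_of_le (fun n => by positivity) (fun n => ?_)
      ((hasSum_digit hx0).summable.add (hasSum_digit (left_nonneg I)).summable)
    rw [← add_mul]
    gcongr
    exact_mod_cast Nat.mod_le _ _
  unfold walshAdd
  have h2 := hs.le_tsum n (fun m _ => by positivity)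
  refine le_trans ?_ h2
  have h3 : (digit n x + digit n I.left) % 2 = 1 := by
    have := digit_le_one n x; have := digit_le_one n I.left; omega
  rw [h3, DyadicInterval.length, Nat.cast_one, one_mul]
  exact zpow_le_zpow_right₀ one_le_two hn

/-! ### Explicit formula for the wave packets -/

/-- The exponent of the sign of a wave packet at `x`, for a tile with a time interval of length
`2 ^ k` and the frequency interval of index `n`: the parity of the common binary digits of `n` and
of the reflected digits of `x`. -/
noncomputable def signExp (k : ℤ) (n : ℕ) (x : ℝ) : ℕ :=
  ∑ i ∈ Finset.range n, n / 2 ^ i % 2 * digit (k - 1 - i) x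

/-- The explicit form of the wave packet of a tile, extended by zero to the negative half-line. -/
noncomputable def packet (p : Tile) : ℝ → ℝ :=
  p.time.toSet.indicator fun x =>
    (√p.time.length)⁻¹ * (-1) ^ signExp p.time.scale p.freq.index x

lemma support_conv_subset {ξ z : ℝ} {a b : ℤ} (hξ : ξ < (2 : ℝ) ^ a) (hz : z < (2 : ℝ) ^ b) :
    (Function.support fun m : ℤ => digit (-1 - m) ξ * digit m z) ⊆ Finset.Icc (-a) b := by
  intro m hm
  rw [Function.mem_support] at hm
  simp only [Finset.coe_Icc, mem_Icc]
  by_contra h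
  apply hm
  rcases lt_or_ge b m with h1 | h1
  · rw [digit_eq_cell m, cell_eq_zero_of_le h1.le hz]; simp
  · rw [digit_eq_cell (-1 - m), cell_eq_zero_of_le (n := -1 - m) (by omega) hξ]; simp

lemma walshChar_eq (ξ z : ℝ) :
    walshChar ξ z = (-1) ^ (∑ᶠ m : ℤ, digit (-1 - m) ξ * digit m z) := by
  unfold walshChar mulDigit
  exact (neg_one_pow_eq_pow_mod_two _).symm

lemma walshChar_of_lt {k : ℤ} {y z : ℝ} (hy : y < (2 : ℝ) ^ k) :
    walshChar y z = (-1) ^ signExp k (cell (-k) z) y := by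
  rw [walshChar_eq]
  congr 1
  have hinj : Function.Injective (fun i : ℕ => (-k + i : ℤ)) := fun a b h => by
    simpa using h
  rw [finsum_eq_sum_of_support_subset (s := (Finset.range (cell (-k) z)).map ⟨_, hinj⟩)]
  · rw [Finset.sum_map]
    refine Finset.sum_congr rfl fun i _ => ?_
    simp only [Function.Embedding.coeFn_mk]
    rw [mul_comm, digit_eq_cell (-k + i), cell_add]
    congr 2
    ring
  · intro m hm
    rw [Function.mem_support] at hm
    have h1 : -k ≤ m := by
      by_contra h
      apply hm
      rw [digit_eq_cell (-1 - m), cell_eq_zero_of_le (n := -1 - m) (by omega) hy]; simp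
    obtain ⟨i, rfl⟩ := Int.le.dest h1
    simp only [Finset.coe_map, Finset.coe_range, Function.Embedding.coeFn_mk, mem_image, mem_Iio]
    refine ⟨i, ?_, rfl⟩
    by_contra h
    apply hm
    rw [digit_eq_cell (-k + i), cell_add, Nat.div_eq_of_lt]
    · simp
    · exact (Nat.lt_two_pow_self).trans_le (Nat.pow_le_pow_right two_pos (not_lt.1 h))

lemma integrableOn_walshChar (y : ℝ) (ω : DyadicInterval) :
    IntegrableOn (walshChar y) ω.toSet := by
  obtain ⟨a, ha⟩ := exists_lt_zpow y
  obtain ⟨b, hb⟩ := exists_lt_zpow (ω.left + ω.length)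
  have hmeas : Measurable fun z : ℝ =>
      (-1 : ℝ) ^ (∑ m ∈ Finset.Icc (-(a : ℤ)) b, digit (-1 - m) y * digit m z) := by
    refine (measurable_of_countable (fun k : ℕ => (-1 : ℝ) ^ k)).comp ?_
    exact Finset.measurable_sum _ fun m _ => (measurable_digit m).const_mul _
  have h1 : IntegrableOn (fun z : ℝ =>
      (-1 : ℝ) ^ (∑ m ∈ Finset.Icc (-(a : ℤ)) b, digit (-1 - m) y * digit m z)) ω.toSet := by
    refine Measure.integrableOn_of_bounded (M := 1) (by simp [DyadicInterval.toSet])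
      hmeas.aestronglyMeasurable ?_
    filter_upwards with z
    simp
  refine h1.congr_fun (fun z hz => ?_) (measurableSet_toSet ω)
  simp only
  rw [walshChar_eq, finsum_eq_sum_of_support_subset _ (support_conv_subset ha (hz.2.trans hb))]

lemma toSet_eq_union (I : DyadicInterval) : I.toSet = I.lowerHalf.toSet ∪ I.upperHalf.toSet := by
  ext x
  simp only [mem_union, mem_toSet, DyadicInterval.lowerHalf, DyadicInterval.upperHalf]
  have h := cell_add_one (I.scale - 1) x
  rw [sub_add_cancel] at h
  rw [h]
  constructor
  · rintro ⟨h0, h1⟩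
    rcases Nat.mod_two_eq_zero_or_one (cell (I.scale - 1) x) with h2 | h2
    · left; exact ⟨h0, by omega⟩
    · right; exact ⟨h0, by omega⟩
  · rintro (⟨h0, h1⟩ | ⟨h0, h1⟩) <;> exact ⟨h0, by omega⟩

lemma disjoint_halves (I : DyadicInterval) : Disjoint I.lowerHalf.toSet I.upperHalf.toSet := by
  rw [Set.disjoint_left]
  intro x hx hy
  rw [mem_toSet] at hx hy
  simp only [DyadicInterval.lowerHalf, DyadicInterval.upperHalf] at hx hy
  omega

lemma lowerHalf_subset (I : DyadicInterval) : I.lowerHalf.toSet ⊆ I.toSet := by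
  rw [toSet_eq_union I]; exact subset_union_left

lemma upperHalf_subset (I : DyadicInterval) : I.upperHalf.toSet ⊆ I.toSet := by
  rw [toSet_eq_union I]; exact subset_union_right

lemma length_lowerHalf (I : DyadicInterval) : I.lowerHalf.length = I.length / 2 := by
  simp only [DyadicInterval.lowerHalf, DyadicInterval.length, zpow_sub_one₀ (two_ne_zero' ℝ)]
  ring

lemma length_upperHalf (I : DyadicInterval) : I.upperHalf.length = I.length / 2 := by
  simp only [DyadicInterval.upperHalf, DyadicInterval.length, zpow_sub_one₀ (two_ne_zero' ℝ)]
  ring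

lemma left_lowerHalf (I : DyadicInterval) : I.lowerHalf.left = I.left := by
  unfold DyadicInterval.left
  rw [length_lowerHalf]
  simp only [DyadicInterval.lowerHalf]
  push_cast; ring

lemma left_upperHalf (I : DyadicInterval) : I.upperHalf.left = I.left + I.length / 2 := by
  unfold DyadicInterval.left
  rw [length_upperHalf]
  simp only [DyadicInterval.upperHalf]
  push_cast; ring

/-- Moving a point from the lower to the upper half of a dyadic interval changes one digit only, the
one that tells the two halves apart. -/
lemma digit_add_half {I : DyadicInterval} {z : ℝ} (hz : z ∈ I.lowerHalf.toSet) (m : ℤ) :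
    digit m (z + I.length / 2) = digit m z + if m = I.scale - 1 then 1 else 0 := by
  have hz' : z + I.length / 2 ∈ I.upperHalf.toSet := by
    unfold DyadicInterval.toSet at *
    rw [left_lowerHalf, length_lowerHalf] at hz
    rw [left_upperHalf, length_upperHalf]
    constructor <;> linarith [hz.1, hz.2]
  rcases lt_trichotomy m (I.scale - 1) with h | h | h
  · rw [if_neg h.ne, add_zero, ← digit_sub_left hz' (m := m) h, ← digit_sub_left hz (m := m) h,
      left_lowerHalf, left_upperHalf]
    congr 1; ring
  · rw [if_pos h, h, digit_eq_cell, digit_eq_cell]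
    rw [mem_toSet] at hz hz'
    simp only [DyadicInterval.lowerHalf, DyadicInterval.upperHalf] at hz hz'
    rw [hz.2, hz'.2]; omega
  · rw [if_neg h.ne', add_zero]
    exact digit_eq_of_mem (upperHalf_subset I hz') (lowerHalf_subset I hz) (by omega)

lemma walshChar_add_half {I : DyadicInterval} {y z : ℝ} (hz : z ∈ I.lowerHalf.toSet)
    (hy : digit (-I.scale) y = 1) : walshChar y (z + I.length / 2) = - walshChar y z := by
  obtain ⟨a, ha⟩ := exists_lt_zpow y
  obtain ⟨b, hb⟩ := exists_lt_zpow z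
  rw [walshChar_eq, walshChar_eq]
  have h1 : (∑ᶠ m : ℤ, digit (-1 - m) y * digit m (z + I.length / 2))
      = (∑ᶠ m : ℤ, digit (-1 - m) y * digit m z) + 1 := by
    have : ∀ m : ℤ, digit (-1 - m) y * digit m (z + I.length / 2)
        = digit (-1 - m) y * digit m z + if m = I.scale - 1 then 1 else 0 := by
      intro m
      rw [digit_add_half hz]
      split_ifs with h
      · rw [show -1 - m = -I.scale by omega, hy]; ring
      · ring
    simp_rw [this]
    rw [finsum_add_distrib ((Finset.finite_toSet _).subset (support_conv_subset ha hb))]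
    · congr 1
      rw [finsum_eq_single _ (I.scale - 1)]
      · simp
      · intro m hm; simp [hm]
    · refine (Set.finite_singleton (I.scale - 1)).subset fun m hm => ?_
      by_contra h
      simp at hm h
      omega
  rw [h1, pow_succ]; ring

lemma integral_walshChar_eq_zero {y : ℝ} {j : ℤ} (hy : digit j y = 1) (d : ℕ) (ω : DyadicInterval)
    (hω : ω.scale = -j + d) : ∫ z in ω.toSet, walshChar y z = 0 := by
  induction d generalizing ω with
  | zero =>
    have hj : digit (-ω.scale) y = 1 := by rw [hω]; simpa using hy
    have h1 : ∀ J : DyadicInterval, ∫ z in J.toSet, walshChar y z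
        = ∫ z in J.left..(J.left + J.length), walshChar y z := by
      intro J
      rw [DyadicInterval.toSet, intervalIntegral.integral_of_le (by linarith [length_pos J]),
        integral_Ico_eq_integral_Ioc]
    have h2 : ∫ z in ω.upperHalf.toSet, walshChar y z
        = ∫ z in ω.lowerHalf.left..(ω.lowerHalf.left + ω.lowerHalf.length),
            walshChar y (z + ω.length / 2) := by
      rw [h1, intervalIntegral.integral_comp_add_right (fun z => walshChar y z), left_lowerHalf,
        length_lowerHalf, left_upperHalf, length_upperHalf,
        add_right_comm]
    have h3 : ∫ z in ω.lowerHalf.left..(ω.lowerHalf.left + ω.lowerHalf.length),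
        walshChar y (z + ω.length / 2) = - ∫ z in ω.lowerHalf.toSet, walshChar y z := by
      rw [intervalIntegral.integral_of_le (by linarith [length_pos ω.lowerHalf]),
        ← integral_Ico_eq_integral_Ioc, ← integral_neg]
      exact setIntegral_congr_fun (measurableSet_toSet ω.lowerHalf)
        fun z hz => walshChar_add_half hz hj
    rw [toSet_eq_union, setIntegral_union (disjoint_halves ω) (measurableSet_toSet _)
      (integrableOn_walshChar _ _) (integrableOn_walshChar _ _), h2, h3]
    ring
  | succ d ih =>
    rw [toSet_eq_union, setIntegral_union (disjoint_halves ω) (measurableSet_toSet _)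
      (integrableOn_walshChar _ _) (integrableOn_walshChar _ _),
      ih ω.lowerHalf (by simp only [DyadicInterval.lowerHalf]; push_cast at hω; omega),
      ih ω.upperHalf (by simp only [DyadicInterval.upperHalf]; push_cast at hω; omega), add_zero]

lemma toSet_subset_Ici (I : DyadicInterval) : I.toSet ⊆ Ici 0 := fun _ hx => nonneg_of_mem hx

lemma walshTransform_indicator (ω : DyadicInterval) (y : ℝ) :
    walshTransform (ω.toSet.indicator 1) y = ∫ z in ω.toSet, walshChar y z := by
  unfold walshTransform halfLine
  have : ∀ x, walshChar y x * ω.toSet.indicator 1 x = ω.toSet.indicator (walshChar y) x := by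
    intro x
    by_cases hx : x ∈ ω.toSet <;> simp [hx]
  simp_rw [this]
  rw [setIntegral_indicator (measurableSet_toSet ω), inter_eq_right.2 (toSet_subset_Ici ω)]

lemma walshTransform_of_lt {ω : DyadicInterval} {y : ℝ}
    (hy : y < (2 : ℝ) ^ (-ω.scale)) :
    walshTransform (ω.toSet.indicator 1) y
      = ω.length * (-1) ^ signExp (-ω.scale) ω.index y := by
  rw [walshTransform_indicator, setIntegral_congr_fun (measurableSet_toSet ω)
    (g := fun _ => (-1 : ℝ) ^ signExp (-ω.scale) ω.index y)]
  · rw [setIntegral_const, smul_eq_mul]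
    congr 1
    simp [DyadicInterval.toSet, Measure.real, (length_pos ω).le]
  · intro z hz
    have := (mem_toSet.1 hz).2
    simp only
    rw [walshChar_of_lt hy, neg_neg, this]

lemma walshTransform_of_ge {ω : DyadicInterval} {y : ℝ}
    (hy : (2 : ℝ) ^ (-ω.scale) ≤ y) : walshTransform (ω.toSet.indicator 1) y = 0 := by
  have hy0 : 0 ≤ y := le_trans (by positivity) hy
  have h1 : ∃ j, -ω.scale ≤ j ∧ digit j y = 1 := by
    by_contra! hcon
    have h2 : cell (-ω.scale) y = cell (-ω.scale) 0 := by
      refine cell_eq_of_digit_eq fun n hn => ?_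
      have := hcon n hn
      have h3 := digit_le_one n y
      have : digit n 0 = 0 := by simp [digit]
      omega
    have h3 : cell (-ω.scale) (0 : ℝ) = 0 := by simp [cell]
    rw [h3, cell, Nat.floor_eq_zero, div_lt_one (by positivity)] at h2
    linarith
  obtain ⟨j, hj, hd⟩ := h1
  rw [walshTransform_indicator]
  exact integral_walshChar_eq_zero hd (ω.scale + j).toNat ω (by omega)

lemma wavePacket_eq_packet (p : Tile) {x : ℝ} (hx : 0 ≤ x) : wavePacket p x = packet p x := by
  have hsc : -p.freq.scale = p.time.scale := by have := p.area; omega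
  unfold wavePacket packet
  by_cases h : x ∈ p.time.toSet
  · rw [indicator_of_mem h, walshAdd_left_of_mem h, walshTransform_of_lt, ← mul_assoc, hsc]
    · congr 1
      · have h1 : p.freq.length = (p.time.length)⁻¹ := by
          unfold DyadicInterval.length
          rw [← zpow_neg, ← hsc, neg_neg]
        rw [h1]
        have h2 := Real.sq_sqrt (length_pos p.time).le
        have h3 := Real.sqrt_pos.2 (length_pos p.time)
        field_simp
        rw [h2, div_self (length_pos _).ne']
      · congr 1
        refine Finset.sum_congr rfl fun i _ => ?_
        rw [digit_sub_left h (by omega)]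
    · rw [hsc]
      have := h.2
      change _ < p.time.length
      linarith
  · rw [indicator_of_notMem h, walshTransform_of_ge, mul_zero]
    rw [hsc]
    exact le_walshAdd_left hx h

/-! ### Dyadic geometry -/

lemma subset_of_mem_of_le {I J : DyadicInterval} {x : ℝ} (hI : x ∈ I.toSet) (hJ : x ∈ J.toSet)
    (h : I.scale ≤ J.scale) : I.toSet ⊆ J.toSet := by
  intro y hy
  rw [mem_toSet] at *
  refine ⟨hy.1, ?_⟩
  rw [← hJ.2, cell_of_le h, cell_of_le h, hI.2, hy.2]

lemma scale_le_of_subset {I J : DyadicInterval} (h : I.toSet ⊆ J.toSet) : I.scale ≤ J.scale := by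
  have h1 := length_pos I
  unfold DyadicInterval.toSet at h
  rw [Ico_subset_Ico_iff (by linarith)] at h
  have h2 : I.length ≤ J.length := by linarith [h.1, h.2]
  exact (zpow_le_zpow_iff_right₀ one_lt_two).1 h2

lemma eq_of_mem_of_scale_eq {I J : DyadicInterval} {x : ℝ} (hI : x ∈ I.toSet) (hJ : x ∈ J.toSet)
    (h : I.scale = J.scale) : I = J := by
  rw [eq_dyad_of_mem hI, eq_dyad_of_mem hJ, h]

lemma disjoint_of_notMem {I J : DyadicInterval} {x : ℝ} (hI : x ∈ I.toSet) (hJ : x ∉ J.toSet)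
    (h : I.scale ≤ J.scale) : Disjoint I.toSet J.toSet := by
  rw [Set.disjoint_left]
  intro y hy hy'
  exact hJ (subset_of_mem_of_le hy hy' h hI)

lemma subset_or_disjoint {I J : DyadicInterval} (h : I.scale ≤ J.scale) :
    I.toSet ⊆ J.toSet ∨ Disjoint I.toSet J.toSet := by
  by_cases hl : I.left ∈ J.toSet
  · exact Or.inl (subset_of_mem_of_le (left_mem I) hl h)
  · exact Or.inr (disjoint_of_notMem (left_mem I) hl h)

lemma subset_half {I J : DyadicInterval} (hIJ : I.toSet ⊆ J.toSet) (h : I.scale < J.scale) :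
    I.toSet ⊆ J.lowerHalf.toSet ∨ I.toSet ⊆ J.upperHalf.toSet := by
  have h1 := hIJ (left_mem I)
  rw [toSet_eq_union] at h1
  rcases h1 with h1 | h1
  · exact Or.inl (subset_of_mem_of_le (left_mem I) h1
      (by simp only [DyadicInterval.lowerHalf]; omega))
  · exact Or.inr (subset_of_mem_of_le (left_mem I) h1
      (by simp only [DyadicInterval.upperHalf]; omega))

/-! ### Orthogonality of the wave packets -/

/-- The tile with time interval `I` whose frequency interval has index `n`. -/
def mkTile (I : DyadicInterval) (n : ℕ) : Tile := ⟨I, ⟨-I.scale, n⟩, by simp⟩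

lemma eq_mkTile (p : Tile) : p = mkTile p.time p.freq.index := by
  have := p.area
  ext
  · rfl
  · rfl
  · simp only [mkTile]; omega
  · rfl

lemma packet_of_notMem {p : Tile} {x : ℝ} (h : x ∉ p.time.toSet) : packet p x = 0 :=
  indicator_of_notMem h _

lemma abs_packet {p : Tile} {x : ℝ} (h : x ∈ p.time.toSet) :
    |packet p x| = (√p.time.length)⁻¹ := by
  unfold packet
  rw [indicator_of_mem h, abs_mul, abs_pow]
  simp

lemma packet_sq {p : Tile} {x : ℝ} (h : x ∈ p.time.toSet) :
    packet p x ^ 2 = p.time.length⁻¹ := by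
  rw [← sq_abs, abs_packet h, inv_pow, Real.sq_sqrt (length_pos _).le]

lemma abs_packet_le (p : Tile) (x : ℝ) : |packet p x| ≤ (√p.time.length)⁻¹ := by
  by_cases h : x ∈ p.time.toSet
  · exact (abs_packet h).le
  · rw [packet_of_notMem h, abs_zero]; positivity

lemma measurable_packet (p : Tile) : Measurable (packet p) := by
  refine Measurable.indicator ?_ (measurableSet_toSet _)
  refine Measurable.const_mul ?_ _
  refine (measurable_of_countable (fun k : ℕ => (-1 : ℝ) ^ k)).comp ?_
  exact Finset.measurable_sum _ fun m _ => (measurable_digit _).const_mul _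

lemma signExp_eq_sum {N n : ℕ} (h : n ≤ N) (k : ℤ) (x : ℝ) :
    signExp k n x = ∑ i ∈ Finset.range N, n / 2 ^ i % 2 * digit (k - 1 - i) x := by
  unfold signExp
  refine Finset.sum_subset (Finset.range_mono h) fun i _ hi => ?_
  rw [Finset.mem_range, not_lt] at hi
  rw [Nat.div_eq_of_lt ((Nat.lt_two_pow_self).trans_le (Nat.pow_le_pow_right two_pos hi))]
  simp

lemma signExp_two_mul_add {b : ℕ} (hb : b < 2) (k : ℤ) (n : ℕ) (x : ℝ) :
    signExp k (2 * n + b) x = b * digit (k - 1) x + signExp (k - 1) n x := by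
  rw [signExp_eq_sum (Nat.le_succ (2 * n + b)), Finset.sum_range_succ', add_comm,
    signExp_eq_sum (N := 2 * n + b) (by omega)]
  congr 1
  · simp only [pow_zero, Nat.div_one, Nat.cast_zero, sub_zero]
    congr 1; omega
  · refine Finset.sum_congr rfl fun i _ => ?_
    rw [pow_succ', ← Nat.div_div_eq_div_mul, show (2 * n + b) / 2 = n by omega]
    congr 2; push_cast; ring

lemma inv_sqrt_length_half (I : DyadicInterval) :
    (√I.length)⁻¹ = (√2)⁻¹ * (√(I.length / 2))⁻¹ := by
  rw [← mul_inv, ← Real.sqrt_mul zero_le_two]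
  congr 2; ring

/-- The wave packets of the two frequency halves of a bitile are the normalized sum and difference
of the wave packets of its two time halves. -/
lemma packet_mkTile_two_mul_add {b : ℕ} (hb : b < 2) (I : DyadicInterval) (n : ℕ) (x : ℝ) :
    packet (mkTile I (2 * n + b)) x
      = (√2)⁻¹ * (packet (mkTile I.lowerHalf n) x
        + (-1) ^ b * packet (mkTile I.upperHalf n) x) := by
  by_cases hI : x ∈ I.toSet
  · have hc : x ∈ I.lowerHalf.toSet ∨ x ∈ I.upperHalf.toSet := by
      rw [toSet_eq_union] at hI; exact hI
    rcases hc with hl | hu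
    · have hd : digit (I.scale - 1) x = 0 := by
        have := (mem_toSet.1 hl).2
        simp only [DyadicInterval.lowerHalf] at this
        rw [digit_eq_cell, this]; omega
      have hu : x ∉ I.upperHalf.toSet := Set.disjoint_left.1 (disjoint_halves I) hl
      rw [packet_of_notMem (p := mkTile I.upperHalf n) hu]
      unfold packet
      simp only [mkTile]
      rw [indicator_of_mem hI, indicator_of_mem hl, signExp_two_mul_add hb, hd, length_lowerHalf,
        inv_sqrt_length_half I]
      simp only [DyadicInterval.lowerHalf, mul_zero, zero_add, add_zero]
      ring
    · have hd : digit (I.scale - 1) x = 1 := by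
        have := (mem_toSet.1 hu).2
        simp only [DyadicInterval.upperHalf] at this
        rw [digit_eq_cell, this]; omega
      have hl : x ∉ I.lowerHalf.toSet := Set.disjoint_right.1 (disjoint_halves I) hu
      rw [packet_of_notMem (p := mkTile I.lowerHalf n) hl]
      unfold packet
      simp only [mkTile]
      rw [indicator_of_mem hI, indicator_of_mem hu, signExp_two_mul_add hb, hd, length_upperHalf,
        inv_sqrt_length_half I, pow_add]
      simp only [DyadicInterval.upperHalf, mul_one, zero_add]
      ring
  · rw [packet_of_notMem (p := mkTile I _) hI,
      packet_of_notMem (p := mkTile I.lowerHalf n) (fun h => hI (lowerHalf_subset I h)),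
      packet_of_notMem (p := mkTile I.upperHalf n) (fun h => hI (upperHalf_subset I h))]
    ring

lemma integrable_mul_packet {f : ℝ → ℝ} (hf : LocallyIntegrableOn f (Ici 0) volume) (p : Tile) :
    Integrable (fun x => f x * packet p x) halfLine := by
  have h1 : IntegrableOn f p.time.toSet := by
    refine (hf.integrableOn_compact_subset (t := Icc p.time.left (p.time.left + p.time.length))
      ?_ isCompact_Icc).mono_set Ico_subset_Icc_self
    exact fun x hx => (left_nonneg _).trans hx.1
  have h2 : IntegrableOn (fun x => f x * packet p x) p.time.toSet := by
    refine Integrable.mul_bdd (c := (√p.time.length)⁻¹) h1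
      (measurable_packet p).aestronglyMeasurable ?_
    filter_upwards with x
    exact abs_packet_le p x
  have h3 : (fun x => f x * packet p x)
      = p.time.toSet.indicator (fun x => f x * packet p x) := by
    ext x
    by_cases h : x ∈ p.time.toSet
    · rw [indicator_of_mem h]
    · rw [indicator_of_notMem h, packet_of_notMem h, mul_zero]
  rw [h3]
  exact (h2.integrable_indicator (measurableSet_toSet _)).mono_measure Measure.restrict_le_self

lemma locallyIntegrableOn_packet (p : Tile) : LocallyIntegrableOn (packet p) (Ici 0) volume := by
  refine LocallyIntegrable.locallyIntegrableOn ?_ _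
  refine (locallyIntegrable_const ((√p.time.length)⁻¹)).mono
    (measurable_packet p).aestronglyMeasurable ?_
  filter_upwards with x
  rw [Real.norm_eq_abs, Real.norm_eq_abs, abs_of_nonneg (a := (√p.time.length)⁻¹) (by positivity)]
  exact abs_packet_le p x

/-- The coefficient `⟨f, φ_p⟩`. -/
noncomputable def coef (f : ℝ → ℝ) (p : Tile) : ℝ := pairing f (packet p)

lemma pairing_wavePacket (f : ℝ → ℝ) (p : Tile) : pairing f (wavePacket p) = coef f p := by
  unfold coef pairing halfLine
  refine setIntegral_congr_fun measurableSet_Ici fun x hx => ?_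
  rw [wavePacket_eq_packet p hx]

lemma coef_mkTile_two_mul_add {f : ℝ → ℝ} (hf : LocallyIntegrableOn f (Ici 0) volume) {b : ℕ}
    (hb : b < 2) (I : DyadicInterval) (n : ℕ) :
    coef f (mkTile I (2 * n + b))
      = (√2)⁻¹ * (coef f (mkTile I.lowerHalf n) + (-1) ^ b * coef f (mkTile I.upperHalf n)) := by
  unfold coef pairing
  have h : ∀ x, f x * packet (mkTile I (2 * n + b)) x = (√2)⁻¹ *
      (f x * packet (mkTile I.lowerHalf n) x
        + (-1) ^ b * (f x * packet (mkTile I.upperHalf n) x)) := by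
    intro x
    rw [packet_mkTile_two_mul_add hb]; ring
  rw [integral_congr_ae (Filter.Eventually.of_forall h), integral_const_mul,
    integral_add (integrable_mul_packet hf _) ((integrable_mul_packet hf _).const_mul _),
    integral_const_mul]

lemma coef_packet_comm (p q : Tile) : coef (packet p) q = coef (packet q) p := by
  unfold coef pairing
  congr 1; ext x; ring

lemma coef_packet_self (p : Tile) : coef (packet p) p = 1 := by
  unfold coef pairing
  have : ∀ x, packet p x * packet p x = p.time.toSet.indicator (fun _ => p.time.length⁻¹) x := by
    intro x
    by_cases h : x ∈ p.time.toSet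
    · rw [indicator_of_mem h, ← packet_sq h, sq]
    · rw [indicator_of_notMem h, packet_of_notMem h, mul_zero]
  simp_rw [this]
  unfold halfLine
  rw [setIntegral_indicator (measurableSet_toSet _), inter_eq_right.2 (toSet_subset_Ici _),
    setIntegral_const, smul_eq_mul]
  have hl := length_pos p.time
  have : volume.real p.time.toSet = p.time.length := by
    simp [DyadicInterval.toSet, Measure.real, hl.le]
  rw [this, mul_inv_cancel₀ hl.ne']

lemma coef_packet_of_disjoint {p q : Tile} (h : Disjoint p.time.toSet q.time.toSet) :
    coef (packet p) q = 0 := by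
  unfold coef pairing
  have : ∀ x, packet p x * packet q x = 0 := by
    intro x
    by_cases hx : x ∈ p.time.toSet
    · rw [packet_of_notMem (Set.disjoint_left.1 h hx), mul_zero]
    · rw [packet_of_notMem hx, zero_mul]
  simp [this]

lemma inv_sqrt_two_sq : (√2 : ℝ)⁻¹ ^ 2 = 1 / 2 := by
  rw [inv_pow, Real.sq_sqrt zero_le_two]; norm_num

lemma coef_packet_same_time (s : ℕ) (I : DyadicInterval) {n m : ℕ} (hs : n + m ≤ s) (h : n ≠ m) :
    coef (packet (mkTile I n)) (mkTile I m) = 0 := by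
  induction s generalizing I n m with
  | zero => omega
  | succ s ih =>
    obtain ⟨a, b, hb, rfl⟩ : ∃ a b, b < 2 ∧ n = 2 * a + b := ⟨n / 2, n % 2, by omega, by omega⟩
    obtain ⟨a', b', hb', rfl⟩ : ∃ a b, b < 2 ∧ m = 2 * a + b := ⟨m / 2, m % 2, by omega, by omega⟩
    have hd := disjoint_halves I
    rw [coef_mkTile_two_mul_add (locallyIntegrableOn_packet _) hb', coef_packet_comm _ (mkTile _ _),
      coef_packet_comm _ (mkTile I.upperHalf _),
      coef_mkTile_two_mul_add (locallyIntegrableOn_packet _) hb,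
      coef_mkTile_two_mul_add (locallyIntegrableOn_packet _) hb,
      coef_packet_of_disjoint (p := mkTile I.lowerHalf _) (q := mkTile I.upperHalf _) hd,
      coef_packet_of_disjoint (p := mkTile I.upperHalf _) (q := mkTile I.lowerHalf _) hd.symm]
    by_cases haa : a = a'
    · subst haa
      rw [coef_packet_self, coef_packet_self]
      interval_cases b <;> interval_cases b' <;> first | omega | simp
    · rw [ih I.lowerHalf (n := a') (m := a) (by omega) (Ne.symm haa),
        ih I.upperHalf (n := a') (m := a) (by omega) (Ne.symm haa)]
      ring

/-- Inner products of wave packets with nested time intervals, by induction on the difference of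
the scales. -/
lemma coef_packet_nested_sq (d : ℕ) {I J : DyadicInterval} (hIJ : I.toSet ⊆ J.toSet)
    (hs : J.scale = I.scale + d) (n m : ℕ) :
    coef (packet (mkTile I n)) (mkTile J m) ^ 2 = if m / 2 ^ d = n then (1 / 2) ^ d else 0 := by
  induction d generalizing J m with
  | zero =>
    have : I = J := eq_of_mem_of_scale_eq (left_mem I) (hIJ (left_mem I)) (by simp [hs])
    subst this
    by_cases h : m = n
    · subst h; simp [coef_packet_self]
    · rw [coef_packet_same_time _ I le_rfl (Ne.symm h)]; simp [h]
  | succ d ih =>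
    obtain ⟨a, b, hb, rfl⟩ : ∃ a b, b < 2 ∧ m = 2 * a + b := ⟨m / 2, m % 2, by omega, by omega⟩
    have hd := disjoint_halves J
    have h1 : (2 * a + b) / 2 ^ (d + 1) = a / 2 ^ d := by
      rw [pow_succ', ← Nat.div_div_eq_div_mul]; congr 1; omega
    have hb1 : ((-1 : ℝ) ^ b) ^ 2 = 1 := by rw [← pow_mul, mul_comm, pow_mul]; simp
    rw [coef_mkTile_two_mul_add (locallyIntegrableOn_packet _) hb, h1]
    rcases subset_half hIJ (by rw [hs]; push_cast; omega) with h | h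
    · rw [coef_packet_of_disjoint (p := mkTile I n) (q := mkTile J.upperHalf a) (hd.mono_left h),
        mul_zero, add_zero, mul_pow, inv_sqrt_two_sq,
        ih h (by simp only [DyadicInterval.lowerHalf]; rw [hs]; push_cast; ring)]
      split_ifs <;> ring
    · rw [coef_packet_of_disjoint (p := mkTile I n) (q := mkTile J.lowerHalf a)
          (hd.symm.mono_left h), zero_add, mul_pow, mul_pow, inv_sqrt_two_sq, hb1,
        ih h (by simp only [DyadicInterval.upperHalf]; rw [hs]; push_cast; ring)]
      split_ifs <;> ring

lemma volume_toSet (I : DyadicInterval) : volume I.toSet = ENNReal.ofReal I.length := by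
  simp [DyadicInterval.toSet]

/-- The squared inner product of two wave packets is the area of the intersection of the tiles. -/
lemma coef_packet_sq_eq_volume (p q : Tile) :
    coef (packet p) q ^ 2 = volume.real (p.toSet ∩ q.toSet) := by
  wlog h : p.time.scale ≤ q.time.scale generalizing p q
  · rw [coef_packet_comm, inter_comm]
    exact this q p (by omega)
  have hp := p.area
  have hq := q.area
  unfold Tile.toSet
  rw [prod_inter_prod]
  rcases subset_or_disjoint h with h1 | h1
  · obtain ⟨d, hd⟩ := Int.le.dest h
    rw [eq_mkTile p, eq_mkTile q, coef_packet_nested_sq d h1 hd.symm, ← eq_mkTile, ← eq_mkTile,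
      inter_eq_left.2 h1]
    have hle : q.freq.scale ≤ p.freq.scale := by omega
    have hcell : cell p.freq.scale q.freq.left = q.freq.index / 2 ^ d := by
      rw [cell_of_le hle, cell_left _ le_rfl]
      congr 2
      · simp
      · omega
    split_ifs with h2
    · have h3 : q.freq.toSet ⊆ p.freq.toSet := by
        refine subset_of_mem_of_le (left_mem _) (mem_toSet.2 ⟨left_nonneg _, ?_⟩) hle
        rw [hcell, h2]
      rw [inter_eq_right.2 h3, Measure.real, Measure.volume_eq_prod, Measure.prod_prod,
        volume_toSet, volume_toSet, ENNReal.toReal_mul, ENNReal.toReal_ofReal (length_pos _).le,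
        ENNReal.toReal_ofReal (length_pos _).le]
      unfold DyadicInterval.length
      rw [← zpow_add₀ two_ne_zero, show p.time.scale + q.freq.scale = -(d : ℤ) by omega]
      simp
    · have h3 : Disjoint q.freq.toSet p.freq.toSet := by
        refine disjoint_of_notMem (left_mem _) (fun hmem => h2 ?_) hle
        rw [← hcell]; exact (mem_toSet.1 hmem).2
      rw [disjoint_iff_inter_eq_empty.1 h3.symm]
      simp
  · rw [coef_packet_of_disjoint h1, disjoint_iff_inter_eq_empty.1 h1]
    simp

/-! ### Phase plane projections -/

lemma memLp_packet (p : Tile) : MemLp (packet p) 2 halfLine := by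
  rw [memLp_two_iff_integrable_sq (measurable_packet p).aestronglyMeasurable]
  simpa [sq] using integrable_mul_packet (locallyIntegrableOn_packet p) p

/-- The wave packet of a tile as an element of `L²`. -/
noncomputable def packetLp (p : Tile) : Lp ℝ 2 halfLine := (memLp_packet p).toLp

lemma coeFn_packetLp (p : Tile) : packetLp p =ᵐ[halfLine] packet p := (memLp_packet p).coeFn_toLp

lemma inner_packetLp (p q : Tile) : inner ℝ (packetLp p) (packetLp q) = coef (packet p) q := by
  rw [L2.inner_def]
  unfold coef pairing
  refine integral_congr_ae ?_
  filter_upwards [coeFn_packetLp p, coeFn_packetLp q] with x h1 h2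
  rw [h1, h2]
  simp [mul_comm]

lemma coef_packet_of_disjoint_toSet {p q : Tile} (h : Disjoint p.toSet q.toSet) :
    coef (packet p) q = 0 := by
  have := coef_packet_sq_eq_volume p q
  rw [disjoint_iff_inter_eq_empty.1 h] at this
  simpa using this

lemma orthonormal_packetLp {c : Finset Tile} (hc : (c : Set Tile).PairwiseDisjoint Tile.toSet) :
    Orthonormal ℝ (fun p : c => packetLp p) := by
  classical
  rw [orthonormal_iff_ite]
  intro p q
  rw [inner_packetLp]
  split_ifs with h
  · rw [h, coef_packet_self]
  · exact coef_packet_of_disjoint_toSet (hc p.2 q.2 (fun h' => h (Subtype.ext h')))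

lemma measurableSet_tile (p : Tile) : MeasurableSet p.toSet :=
  (measurableSet_toSet _).prod (measurableSet_toSet _)

lemma volume_tile (p : Tile) : volume.real p.toSet = 1 := by
  rw [← inter_self p.toSet, ← coef_packet_sq_eq_volume, coef_packet_self, one_pow]

/-- Parseval's identity for a wave packet whose tile is covered by a tiling, which holds because the
squared inner products add up to the area of the tile. -/
lemma sum_coef_sq_eq_one {c : Finset Tile} {S : Set (ℝ × ℝ)} (hc : IsTiling c S) {q : Tile}
    (hq : q.toSet ⊆ S) : ∑ p ∈ c, coef (packet p) q ^ 2 = 1 := by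
  have h1 : q.toSet = ⋃ p ∈ c, p.toSet ∩ q.toSet := by
    rw [← iUnion₂_inter, hc.2, inter_eq_right.2 hq]
  simp_rw [coef_packet_sq_eq_volume]
  have hfin : ∀ p ∈ c, volume (p.toSet ∩ q.toSet) ≠ ⊤ := fun p _ =>
    measure_ne_top_of_subset inter_subset_right fun h => by
      have := volume_tile q
      simp [Measure.real, h] at this
  rw [← measureReal_biUnion_finset, ← h1, volume_tile]
  · exact fun p hp p' hp' hne => (hc.1 hp hp' hne).mono inter_subset_left inter_subset_left
  · exact fun p _ => (measurableSet_tile p).inter (measurableSet_tile q)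

lemma packetLp_eq_sum {c : Finset Tile} {S : Set (ℝ × ℝ)} (hc : IsTiling c S) {q : Tile}
    (hq : q.toSet ⊆ S) : packetLp q = ∑ p : c, coef (packet p) q • packetLp p := by
  have ho := orthonormal_packetLp hc.1
  rw [← sub_eq_zero, ← norm_eq_zero, ← sq_eq_zero_iff, norm_sub_sq_real,
    ← real_inner_self_eq_norm_sq, ← real_inner_self_eq_norm_sq, inner_packetLp, coef_packet_self, inner_sum, ho.inner_sum]
  simp_rw [inner_smul_right, inner_packetLp, coef_packet_comm q]
  have h1 := sum_coef_sq_eq_one hc hq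
  rw [← Finset.sum_coe_sort] at h1
  simp only [conj_trivial, ← sq]
  rw [h1]; ring

lemma coef_eq_sum {f : ℝ → ℝ} (hf : LocallyIntegrableOn f (Ici 0) volume) {c : Finset Tile}
    {S : Set (ℝ × ℝ)} (hc : IsTiling c S) {q : Tile} (hq : q.toSet ⊆ S) :
    coef f q = ∑ p : c, coef (packet p) q * coef f p := by
  unfold coef pairing
  simp_rw [← integral_const_mul]
  rw [← integral_finsetSum _ fun p _ => (integrable_mul_packet hf _).const_mul _]
  refine integral_congr_ae ?_
  have h1 : packetLp q =ᵐ[halfLine] fun x => ∑ p : c, coef (packet p) q * packet p x := by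
    rw [packetLp_eq_sum hc hq]
    have h2 : ∀ p : c, ∀ᵐ x ∂halfLine, (coef (packet p) q • packetLp p : Lp ℝ 2 halfLine) x
        = coef (packet p) q * packet p x := by
      intro p
      filter_upwards [Lp.coeFn_smul (coef (packet p) q) (packetLp p), coeFn_packetLp p]
        with x h3 h4
      rw [h3, Pi.smul_apply, h4, smul_eq_mul]
    filter_upwards [Lp.coeFn_finsetSum Finset.univ
      (fun p : c => (coef (packet p) q • packetLp p : Lp ℝ 2 halfLine)),
      ae_all_iff.2 h2] with x h3 h4
    rw [h3, Finset.sum_apply]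
    exact Finset.sum_congr rfl fun p _ => h4 p
  filter_upwards [h1, coeFn_packetLp q] with x h2 h3
  rw [← h3, h2, Finset.mul_sum]
  exact Finset.sum_congr rfl fun p _ => by unfold coef pairing; ring

/-- Bessel's inequality for disjoint tiles inside a region that has a tiling. -/
lemma sum_coef_sq_le {f : ℝ → ℝ} (hf : LocallyIntegrableOn f (Ici 0) volume) {S : Set (ℝ × ℝ)}
    (hS : ∃ c, IsTiling c S) {D : Finset Tile} (hD : (D : Set Tile).PairwiseDisjoint Tile.toSet)
    (hDS : ∀ q ∈ D, q.toSet ⊆ S) :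
    ENNReal.ofReal (∑ q ∈ D, coef f q ^ 2) ≤ eLpNorm (projection S f) 2 halfLine ^ 2 := by
  obtain ⟨c, hc, hproj⟩ : ∃ c, IsTiling c S ∧
      ∀ x, projection S f x = ∑ p ∈ c, pairing f (wavePacket p) * wavePacket p x :=
    ⟨hS.choose, hS.choose_spec, fun x => by unfold projection; rw [dif_pos hS]⟩
  let v : Lp ℝ 2 halfLine := ∑ p : c, coef f p • packetLp p
  have hv : v =ᵐ[halfLine] projection S f := by
    have h2 : ∀ p : c, ∀ᵐ x ∂halfLine, (coef f p • packetLp p : Lp ℝ 2 halfLine) x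
        = coef f p * packet p x := by
      intro p
      filter_upwards [Lp.coeFn_smul (coef f p) (packetLp p), coeFn_packetLp p] with x h3 h4
      rw [h3, Pi.smul_apply, h4, smul_eq_mul]
    filter_upwards [Lp.coeFn_finsetSum Finset.univ
      (fun p : c => (coef f p • packetLp p : Lp ℝ 2 halfLine)), ae_all_iff.2 h2,
      (ae_restrict_mem measurableSet_Ici : ∀ᵐ x ∂halfLine, x ∈ Ici (0 : ℝ))] with x h3 h4 h5
    rw [hproj, ← Finset.sum_coe_sort, h3, Finset.sum_apply]
    refine Finset.sum_congr rfl fun p _ => ?_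
    rw [h4 p, pairing_wavePacket, wavePacket_eq_packet _ h5]
  have h1 : ∀ q : D, inner ℝ (packetLp q) v = coef f q := by
    intro q
    rw [coef_eq_sum hf hc (hDS q q.2), inner_sum]
    refine Finset.sum_congr rfl fun p _ => ?_
    rw [inner_smul_right, inner_packetLp, coef_packet_comm, mul_comm]
  have h2 := (orthonormal_packetLp hD).sum_inner_products_le (x := v) (s := Finset.univ)
  simp_rw [h1, Real.norm_eq_abs, sq_abs] at h2
  rw [Finset.sum_coe_sort D (fun q => coef f q ^ 2)] at h2
  rw [← eLpNorm_congr_ae hv, ← Lp.enorm_def]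
  refine (ENNReal.ofReal_le_ofReal h2).trans ?_
  rw [ENNReal.ofReal_pow (norm_nonneg _), ofReal_norm]

/-! ### Bitiles and tiles through a fixed frequency -/

/-- The index of the other half of the dyadic interval one of whose halves has index `n`. -/
def sibling (n : ℕ) : ℕ := if n % 2 = 0 then n + 1 else n - 1

/-- The bitile with time interval `J` whose frequency interval contains `ξ`. -/
noncomputable def bitileAt (ξ : ℝ) (J : DyadicInterval) : Bitile :=
  ⟨J, dyad (1 - J.scale) ξ, by simp [dyad]⟩

/-- The tile with time interval `J` whose frequency interval contains `ξ`. -/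
noncomputable def mainTile (ξ : ℝ) (J : DyadicInterval) : Tile := mkTile J (cell (-J.scale) ξ)

/-- The half of the bitile `bitileAt ξ J` whose frequency interval does not contain `ξ`. -/
noncomputable def otherTile (ξ : ℝ) (J : DyadicInterval) : Tile :=
  mkTile J (sibling (cell (-J.scale) ξ))

/-- The dyadic interval of twice the length containing `J`. -/
def parent (J : DyadicInterval) : DyadicInterval := ⟨J.scale + 1, J.index / 2⟩

lemma subset_parent (J : DyadicInterval) : J.toSet ⊆ (parent J).toSet := by
  intro x hx
  rw [mem_toSet] at *
  refine ⟨hx.1, ?_⟩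
  simp only [parent]
  rw [cell_add_one, hx.2]

lemma eq_bitileAt {P : Bitile} {ξ : ℝ} (h : ξ ∈ P.freq.toSet) : P = bitileAt ξ P.time := by
  have ha := P.area
  have h1 := eq_dyad_of_mem h
  have h2 : P.freq.scale = 1 - P.time.scale := by omega
  rw [h2] at h1
  cases P
  simp only [bitileAt] at *
  simp [h1]

lemma mem_bitileAt {ξ x η : ℝ} {J : DyadicInterval} : (x, η) ∈ (bitileAt ξ J).toSet ↔
    x ∈ J.toSet ∧ 0 ≤ η ∧ cell (1 - J.scale) η = cell (1 - J.scale) ξ := by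
  unfold Bitile.toSet
  rw [mem_prod, mem_toSet (x := η)]
  rfl

lemma mem_mkTile {x η : ℝ} {J : DyadicInterval} {n : ℕ} : (x, η) ∈ (mkTile J n).toSet ↔
    x ∈ J.toSet ∧ 0 ≤ η ∧ cell (-J.scale) η = n := by
  unfold Tile.toSet
  rw [mem_prod, mem_toSet (x := η)]
  rfl

lemma cell_one_sub (s : ℤ) (ξ : ℝ) : cell (1 - s) ξ = cell (-s) ξ / 2 := by
  rw [← cell_add_one]; congr 1; ring

lemma mem_otherTile {ξ x η : ℝ} {J : DyadicInterval} : (x, η) ∈ (otherTile ξ J).toSet ↔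
    (x, η) ∈ (bitileAt ξ J).toSet ∧ cell (-J.scale) η ≠ cell (-J.scale) ξ := by
  unfold otherTile
  rw [mem_mkTile, mem_bitileAt, cell_one_sub, cell_one_sub]
  unfold sibling
  split_ifs <;> constructor
  · rintro ⟨h1, h2, h3⟩; exact ⟨⟨h1, h2, by omega⟩, by omega⟩
  · rintro ⟨⟨h1, h2, h3⟩, h4⟩; exact ⟨h1, h2, by omega⟩
  · rintro ⟨h1, h2, h3⟩; exact ⟨⟨h1, h2, by omega⟩, by omega⟩
  · rintro ⟨⟨h1, h2, h3⟩, h4⟩; exact ⟨h1, h2, by omega⟩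

lemma mem_mainTile {ξ x η : ℝ} {J : DyadicInterval} : (x, η) ∈ (mainTile ξ J).toSet ↔
    x ∈ J.toSet ∧ 0 ≤ η ∧ cell (-J.scale) η = cell (-J.scale) ξ := mem_mkTile

lemma otherTile_subset (ξ : ℝ) (J : DyadicInterval) :
    (otherTile ξ J).toSet ⊆ (bitileAt ξ J).toSet := fun _ hx => (mem_otherTile.1 hx).1

lemma mainTile_subset (ξ : ℝ) (J : DyadicInterval) :
    (mainTile ξ J).toSet ⊆ (bitileAt ξ J).toSet := by
  rintro ⟨x, η⟩ hx
  rw [mem_mainTile] at hx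
  rw [mem_bitileAt, cell_one_sub, cell_one_sub, hx.2.2]
  exact ⟨hx.1, hx.2.1, rfl⟩

lemma cell_eq_of_le {m n : ℤ} (h : m ≤ n) {x y : ℝ} (hxy : cell m x = cell m y) :
    cell n x = cell n y := by
  rw [cell_of_le h, cell_of_le h, hxy]

lemma bitileAt_le {ξ : ℝ} (hξ : 0 ≤ ξ) {I J : DyadicInterval} (h : I.toSet ⊆ J.toSet) :
    bitileAt ξ I ≤ bitileAt ξ J := by
  refine ⟨?_, h⟩
  have hs := scale_le_of_subset h
  exact subset_of_mem_of_le (mem_dyad hξ) (mem_dyad hξ)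
    (by simp only [bitileAt, dyad]; omega)

/-- The tiles of a tree that avoid its top frequency are pairwise disjoint. -/
lemma disjoint_otherTile (ξ : ℝ) {I J : DyadicInterval} (h : I ≠ J) :
    Disjoint (otherTile ξ I).toSet (otherTile ξ J).toSet := by
  wlog hs : I.scale ≤ J.scale generalizing I J
  · exact (this h.symm (by omega)).symm
  rw [Set.disjoint_left]
  rintro ⟨x, η⟩ h1 h2
  rw [mem_otherTile, mem_bitileAt] at h1 h2
  have hne : I.scale ≠ J.scale := fun h' => h (eq_of_mem_of_scale_eq h1.1.1 h2.1.1 h')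
  exact h1.2 (cell_eq_of_le (by omega) h2.1.2.2)

/-- The region of a convex tree has a tiling: the halves of the bitiles that avoid the top
frequency, and the other halves of those bitiles whose parent is not in the tree. -/
lemma exists_isTiling {B : Finset Bitile} (hB : IsConvex B) {ξ : ℝ} (hξ : 0 ≤ ξ)
    (hmem : ∀ P ∈ B, ξ ∈ P.freq.toSet) : ∃ c, IsTiling c (⋃ P ∈ B, P.toSet) := by
  classical
  have hmax : ∀ {I J : DyadicInterval} {x : ℝ}, bitileAt ξ I ∈ B → bitileAt ξ (parent I) ∉ B →
      bitileAt ξ J ∈ B → x ∈ I.toSet → x ∈ J.toSet → J.scale ≤ I.scale := by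
    intro I J x hI hp hJ hx hx'
    by_contra hs
    refine hp (hB _ _ _ hI hJ (bitileAt_le hξ (subset_parent I)) (bitileAt_le hξ ?_))
    exact subset_of_mem_of_le (subset_parent I hx) hx' (by simp only [parent]; omega)
  refine ⟨B.image (fun P => otherTile ξ P.time) ∪
    (B.filter fun P => bitileAt ξ (parent P.time) ∉ B).image (fun P => mainTile ξ P.time), ?_, ?_⟩
  · have hom : ∀ P ∈ B, ∀ Q ∈ B, bitileAt ξ (parent Q.time) ∉ B →
        Disjoint (otherTile ξ P.time).toSet (mainTile ξ Q.time).toSet := by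
      intro P hP Q hQ hQp
      rw [Set.disjoint_left]
      rintro ⟨x, η⟩ h1 h2
      rw [mem_otherTile, mem_bitileAt] at h1
      rw [mem_mainTile] at h2
      have hle : P.time.scale ≤ Q.time.scale :=
        hmax (eq_bitileAt (hmem Q hQ) ▸ hQ) hQp (eq_bitileAt (hmem P hP) ▸ hP) h2.1 h1.1.1
      exact h1.2 (cell_eq_of_le (by omega) h2.2.2)
    intro p hp q hq hne
    simp only [Finset.coe_union, Finset.coe_image, mem_union, mem_image, Finset.mem_coe,
      Finset.mem_filter] at hp hq
    rcases hp with ⟨P, hP, rfl⟩ | ⟨P, ⟨hP, hPp⟩, rfl⟩ <;>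
      rcases hq with ⟨Q, hQ, rfl⟩ | ⟨Q, ⟨hQ, hQp⟩, rfl⟩
    · exact disjoint_otherTile ξ fun h => hne (by rw [h])
    · exact hom P hP Q hQ hQp
    · exact (hom Q hQ P hP hPp).symm
    · simp only [Function.onFun]
      rw [Set.disjoint_left]
      rintro ⟨x, η⟩ h1 h2
      rw [mem_mainTile] at h1 h2
      have hP' := eq_bitileAt (hmem P hP) ▸ hP
      have hQ' := eq_bitileAt (hmem Q hQ) ▸ hQ
      refine hne ?_
      rw [eq_of_mem_of_scale_eq h1.1 h2.1 (le_antisymm (hmax hQ' hQp hP' h2.1 h1.1)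
        (hmax hP' hPp hQ' h1.1 h2.1))]
  · apply subset_antisymm
    · refine iUnion₂_subset fun p hp => ?_
      simp only [Finset.mem_union, Finset.mem_image, Finset.mem_filter] at hp
      rcases hp with ⟨P, hP, rfl⟩ | ⟨P, ⟨hP, -⟩, rfl⟩
      · refine (otherTile_subset ξ _).trans ?_
        rw [← eq_bitileAt (hmem P hP)]
        exact subset_biUnion_of_mem (u := fun P : Bitile => P.toSet) hP
      · refine (mainTile_subset ξ _).trans ?_
        rw [← eq_bitileAt (hmem P hP)]
        exact subset_biUnion_of_mem (u := fun P : Bitile => P.toSet) hP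
    · rintro ⟨x, η⟩ hx
      -- A bitile of maximal scale through the point has a half of the tiling through the point.
      obtain ⟨P, hP, hPmax⟩ := (B.filter fun P => (x, η) ∈ P.toSet).exists_max_image
        (fun P => P.time.scale) (by
          simp only [mem_iUnion] at hx
          obtain ⟨P, hP, hx⟩ := hx
          exact ⟨P, Finset.mem_filter.2 ⟨hP, hx⟩⟩)
      rw [Finset.mem_filter] at hP
      obtain ⟨hP, hxP⟩ := hP
      have hxP' := hxP
      rw [eq_bitileAt (hmem P hP)] at hxP'
      simp only [Finset.mem_union, Finset.mem_image, Finset.mem_filter, mem_iUnion]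
      by_cases hc : cell (-P.time.scale) η = cell (-P.time.scale) ξ
      · refine ⟨mainTile ξ P.time, Or.inr ⟨P, ⟨hP, fun hp => ?_⟩, rfl⟩, ?_⟩
        · have h1 := hPmax (bitileAt ξ (parent P.time)) (Finset.mem_filter.2 ⟨hp, ?_⟩)
          · simp only [bitileAt, parent] at h1
            omega
          · rw [mem_bitileAt] at hxP' ⊢
            refine ⟨subset_parent _ hxP'.1, hxP'.2.1, ?_⟩
            simpa [parent] using hc
        · rw [mem_bitileAt] at hxP'
          exact mem_mainTile.2 ⟨hxP'.1, hxP'.2.1, hc⟩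
      · exact ⟨otherTile ξ P.time, Or.inl ⟨P, hP, rfl⟩, mem_otherTile.2 ⟨hxP', hc⟩⟩

/-! ### The Carleson packing condition -/

lemma sum_coef_sq_le_of_size {f : ℝ → ℝ} (hf : LocallyIntegrableOn f (Ici 0) volume) {T : Tree}
    (hT : IsConvex T.bitiles) {s : ℝ} (hs : 0 ≤ s) (hsize : size T.bitiles f ≤ ENNReal.ofReal s)
    (J : DyadicInterval) {D : Finset Tile} (hD : (D : Set Tile).PairwiseDisjoint Tile.toSet)
    (hDJ : ∀ q ∈ D, ∃ P ∈ T.bitiles, P.time.toSet ⊆ J.toSet ∧ q.toSet ⊆ P.toSet) :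
    ∑ q ∈ D, coef f q ^ 2 ≤ s ^ 2 * J.length := by
  classical
  let B : Finset Bitile := T.bitiles.filter fun P => P.time.toSet ⊆ J.toSet
  have hBT : B ⊆ T.bitiles := Finset.filter_subset _ _
  have hBc : IsConvex B := by
    intro P₁ P₂ P₃ h1 h3 h12 h23
    simp only [B, Finset.mem_filter] at h1 h3 ⊢
    exact ⟨hT _ _ _ h1.1 h3.1 h12 h23, h23.2.trans h3.2⟩
  let T' : Tree := ⟨B, T.topFreq, J, fun P hP => (Finset.mem_filter.1 hP).2,
    fun P hP => T.freq_mem P (hBT hP), T.topFreq_nonneg⟩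
  have h1 : T'.topLength ^ (-(1 / 2) : ℝ) * eLpNorm (T'.proj f) 2 halfLine ≤ ENNReal.ofReal s := by
    refine le_trans ?_ hsize
    unfold size
    exact le_iSup₂_of_le T' hBT (le_iSup_of_le hBc le_rfl)
  have h2 := sum_coef_sq_le hf (exists_isTiling hBc T.topFreq_nonneg T'.freq_mem) hD
    (fun q hq => by
      obtain ⟨P, hP, hPJ, hqP⟩ := hDJ q hq
      exact hqP.trans (subset_biUnion_of_mem (u := fun P : Bitile => P.toSet)
        (show P ∈ B from Finset.mem_filter.2 ⟨hP, hPJ⟩)))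
  change _ ≤ eLpNorm (T'.proj f) 2 halfLine ^ 2 at h2
  have hJ := length_pos J
  have hL0 : T'.topLength ≠ 0 := by simp [Tree.topLength, T', hJ]
  have hLt : T'.topLength ≠ ⊤ := by simp [Tree.topLength]
  have h3 : eLpNorm (T'.proj f) 2 halfLine ≤ T'.topLength ^ (1 / 2 : ℝ) * ENNReal.ofReal s := by
    refine le_trans (le_of_eq ?_) (mul_le_mul_right h1 _)
    rw [← mul_assoc, ← ENNReal.rpow_add _ _ hL0 hLt]
    simp
  have h4 : (T'.topLength ^ (1 / 2 : ℝ) * ENNReal.ofReal s) ^ 2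
      = ENNReal.ofReal (s ^ 2 * J.length) := by
    rw [mul_pow, ← ENNReal.rpow_natCast, ← ENNReal.rpow_mul, ENNReal.ofReal_mul (by positivity),
      ENNReal.ofReal_pow hs, mul_comm]
    simp [Tree.topLength, T']
  have h5 := h2.trans ((pow_le_pow_left' h3 2).trans_eq h4)
  exact (ENNReal.ofReal_le_ofReal_iff (by positivity)).1 h5

lemma sum_coef_otherTile_sq_le {f : ℝ → ℝ} (hf : LocallyIntegrableOn f (Ici 0) volume) {T : Tree}
    (hT : IsConvex T.bitiles) {s : ℝ} (hs : 0 ≤ s) (hsize : size T.bitiles f ≤ ENNReal.ofReal s)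
    {ξ : ℝ} {N : Finset DyadicInterval} (hN : ∀ I ∈ N, bitileAt ξ I ∈ T.bitiles)
    {J : DyadicInterval} (hNJ : ∀ I ∈ N, I.toSet ⊆ J.toSet) :
    ∑ I ∈ N, coef f (otherTile ξ I) ^ 2 ≤ s ^ 2 * J.length := by
  classical
  have hinj : Set.InjOn (otherTile ξ) N := fun I _ I' _ h => congrArg Tile.time h
  rw [← Finset.sum_image (f := fun q => coef f q ^ 2) hinj]
  refine sum_coef_sq_le_of_size hf hT hs hsize J ?_ ?_
  · intro p hp q hq hne
    simp only [Finset.coe_image, mem_image] at hp hq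
    obtain ⟨I, _, rfl⟩ := hp
    obtain ⟨I', _, rfl⟩ := hq
    exact disjoint_otherTile ξ fun h => hne (by rw [h])
  · intro q hq
    obtain ⟨I, hI, rfl⟩ := Finset.mem_image.1 hq
    exact ⟨_, hN I hI, hNJ I hI, otherTile_subset ξ I⟩

lemma coef_sq_le_of_size {f : ℝ → ℝ} (hf : LocallyIntegrableOn f (Ici 0) volume) {T : Tree}
    (hT : IsConvex T.bitiles) {s : ℝ} (hs : 0 ≤ s) (hsize : size T.bitiles f ≤ ENNReal.ofReal s)
    {q : Tile} {P : Bitile} (hP : P ∈ T.bitiles) (hq : q.toSet ⊆ P.toSet) :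
    coef f q ^ 2 ≤ s ^ 2 * P.time.length := by
  have := sum_coef_sq_le_of_size hf hT hs hsize P.time (D := {q}) (by simp)
    (fun q' hq' => ⟨P, hP, Subset.rfl, by rw [Finset.mem_singleton.1 hq']; exact hq⟩)
  simpa using this

/-! ### Greedy counting of jumps -/

/-- The greedy jump counter along a sequence with increments `β`: the current deviation from an
anchor is tracked, starting from `δ`; as soon as it reaches `lam` in absolute value a jump is
counted and the current position becomes the new anchor. After `i` steps the value is the pair of
the number of jumps and the deviation from the anchor. -/
noncomputable def greedy (lam : ℝ) (β : ℕ → ℝ) (δ : ℝ) : ℕ → ℕ × ℝ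
  | 0 => (0, δ)
  | i + 1 =>
    if lam ≤ |(greedy lam β δ i).2 + β i| then ((greedy lam β δ i).1 + 1, 0)
    else ((greedy lam β δ i).1, (greedy lam β δ i).2 + β i)

lemma greedy_succ_of_le {lam : ℝ} {β : ℕ → ℝ} {δ : ℝ} (h : lam ≤ |δ + β 0|) (i : ℕ) :
    greedy lam β δ (i + 1) = ((greedy lam (fun i => β (i + 1)) 0 i).1 + 1,
      (greedy lam (fun i => β (i + 1)) 0 i).2) := by
  induction i with
  | zero => simp [greedy, h]
  | succ i ih =>
    rw [greedy, ih, greedy]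
    simp only
    split_ifs <;> rfl

lemma greedy_succ_of_lt {lam : ℝ} {β : ℕ → ℝ} {δ : ℝ} (h : |δ + β 0| < lam) (i : ℕ) :
    greedy lam β δ (i + 1) = greedy lam (fun i => β (i + 1)) (δ + β 0) i := by
  induction i with
  | zero => simp [greedy, not_le.2 h]
  | succ i ih => rw [greedy, ih, greedy]

lemma greedy_fst_mono (lam : ℝ) (β : ℕ → ℝ) (δ : ℝ) : Monotone fun i => (greedy lam β δ i).1 := by
  refine monotone_nat_of_le_succ fun i => ?_
  simp only [greedy]
  split_ifs
  · exact Nat.le_succ _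
  · exact le_rfl

lemma abs_greedy_snd_le {lam : ℝ} (hlam : 0 ≤ lam) (β : ℕ → ℝ) (i : ℕ) :
    |(greedy lam β 0 i).2| ≤ lam := by
  induction i with
  | zero => simpa [greedy] using hlam
  | succ i ih =>
    simp only [greedy]
    split_ifs with h
    · simpa using hlam
    · exact (not_le.1 h).le

/-- Between two times, the sequence moves by at most `2 * lam` plus a bounded amount for each jump
counted in between. -/
lemma abs_sum_Ico_le {lam s : ℝ} (hlam : 0 ≤ lam) (hls : lam ≤ s) {β : ℕ → ℝ}
    (hβ : ∀ i, |β i| ≤ s) {i j : ℕ} (hij : i ≤ j) :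
    |∑ l ∈ Finset.range j, β l - ∑ l ∈ Finset.range i, β l|
      ≤ 2 * lam + 2 * s * ((greedy lam β 0 j).1 - (greedy lam β 0 i).1) := by
  have anchor : |(∑ l ∈ Finset.range j, β l - (greedy lam β 0 j).2)
      - (∑ l ∈ Finset.range i, β l - (greedy lam β 0 i).2)|
      ≤ 2 * s * ((greedy lam β 0 j).1 - (greedy lam β 0 i).1) := by
    induction j, hij using Nat.le_induction with
    | base => simp
    | succ j _ ih =>
      rw [Finset.sum_range_succ, greedy]
      have h1 := abs_greedy_snd_le hlam β j
      have h2 := hβ j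
      split_ifs
      · push_cast
        simp only [abs_le] at *
        constructor <;> linarith
      · simp only
        convert ih using 2
        ring
  have h1 := abs_greedy_snd_le hlam β i
  have h2 := abs_greedy_snd_le hlam β j
  simp only [abs_le] at *
  constructor <;> linarith

/-! ### Exponential integrability of the number of jumps -/

/-- The difference, on the time interval `J`, of the dyadic martingale obtained from `f` by
demodulation with the frequency `ξ`, if `J` belongs to the set `N`. -/
noncomputable def increment (f : ℝ → ℝ) (ξ : ℝ) (N : Finset DyadicInterval) (J : DyadicInterval)
    (x : ℝ) : ℝ :=
  open Classical in
  if J ∈ N then coef f (otherTile ξ J) * packet (otherTile ξ J) x else 0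

/-- The increments along the dyadic intervals containing `x`, from the scale `k` downwards. -/
noncomputable def path (f : ℝ → ℝ) (ξ : ℝ) (N : Finset DyadicInterval) (k : ℤ) (x : ℝ) (i : ℕ) :
    ℝ :=
  increment f ξ N (dyad (k - i) x) x

/-- The sum of the squared coefficients that live on subintervals of `J`. -/
noncomputable def mass (f : ℝ → ℝ) (ξ : ℝ) (N : Finset DyadicInterval) (J : DyadicInterval) : ℝ :=
  open Classical in
  ∑ I ∈ N.filter (fun I => I.toSet ⊆ J.toSet), coef f (otherTile ξ I) ^ 2

lemma mass_nonneg (f : ℝ → ℝ) (ξ : ℝ) (N : Finset DyadicInterval) (J : DyadicInterval) :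
    0 ≤ mass f ξ N J := Finset.sum_nonneg fun _ _ => sq_nonneg _

open Classical in
lemma mass_halves_le (f : ℝ → ℝ) (ξ : ℝ) (N : Finset DyadicInterval) (J : DyadicInterval) :
    mass f ξ N J.lowerHalf + mass f ξ N J.upperHalf
      + (if J ∈ N then coef f (otherTile ξ J) ^ 2 else 0) ≤ mass f ξ N J := by
  have hl : ∀ I : DyadicInterval, I.toSet ⊆ J.lowerHalf.toSet → ¬ I.toSet ⊆ J.upperHalf.toSet :=
    fun I h h' => Set.disjoint_left.1 (disjoint_halves J) (h (left_mem I)) (h' (left_mem I))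
  have hJl : ¬ J.toSet ⊆ J.lowerHalf.toSet := fun h => by
    have := scale_le_of_subset h
    simp only [DyadicInterval.lowerHalf] at this
    omega
  have hJu : ¬ J.toSet ⊆ J.upperHalf.toSet := fun h => by
    have := scale_le_of_subset h
    simp only [DyadicInterval.upperHalf] at this
    omega
  have h1 : (if J ∈ N then coef f (otherTile ξ J) ^ 2 else 0)
      = ∑ I ∈ N, if J = I then coef f (otherTile ξ I) ^ 2 else 0 := by
    rw [Finset.sum_ite_eq]
  unfold mass
  rw [h1, Finset.sum_filter, Finset.sum_filter, Finset.sum_filter, ← Finset.sum_add_distrib,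
    ← Finset.sum_add_distrib]
  refine Finset.sum_le_sum fun I _ => ?_
  have hsq := sq_nonneg (coef f (otherTile ξ I))
  by_cases h1 : I.toSet ⊆ J.lowerHalf.toSet
  · have h2 : J ≠ I := fun h => hJl (by rw [h] at h1 ⊢; exact h1)
    simp [h1, hl I h1, h2, h1.trans (lowerHalf_subset J)]
  · by_cases h3 : I.toSet ⊆ J.upperHalf.toSet
    · have h2 : J ≠ I := fun h => hJu (by rw [h] at h3 ⊢; exact h3)
      simp [h1, h3, h2, h3.trans (upperHalf_subset J)]
    · by_cases h2 : J = I
      · subst h2; simp [h1, h3]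
      · simp only [h1, h3, h2, if_false, add_zero]
        split_ifs <;> simp [hsq]

lemma sqrt_mul_packet_half {b : ℕ} (hb : b < 2) (J : DyadicInterval) (n : ℕ) (x : ℝ) :
    √J.length * packet (mkTile J (2 * n + b)) x
      = √(J.length / 2) * packet (mkTile J.lowerHalf n) x
        + (-1) ^ b * (√(J.length / 2) * packet (mkTile J.upperHalf n) x) := by
  have h1 : √J.length * (√2)⁻¹ = √(J.length / 2) := by
    rw [Real.sqrt_div (length_pos J).le, div_eq_mul_inv]
  rw [packet_mkTile_two_mul_add hb, ← h1]
  ring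

lemma abs_sqrt_mul_packet {p : Tile} {x : ℝ} (h : x ∈ p.time.toSet) :
    |√p.time.length * packet p x| = 1 := by
  rw [abs_mul, abs_packet h, abs_of_nonneg (Real.sqrt_nonneg _), mul_inv_cancel₀]
  exact (Real.sqrt_pos.2 (length_pos _)).ne'

/-- On the halves of `J`, the normalized wave packets of the two halves of the bitile at `J` agree
up to a sign with those of the tiles at the halves of `J`; the two signs agree on one half of `J`
and differ on the other. -/
lemma exists_sign (ξ : ℝ) (J : DyadicInterval) : ∃ ε : ℝ, ε ^ 2 = 1 ∧
    (∀ x ∈ J.lowerHalf.toSet,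
      √J.length * packet (mainTile ξ J) x
          = √J.lowerHalf.length * packet (mainTile ξ J.lowerHalf) x ∧
        √J.length * packet (otherTile ξ J) x
          = √J.lowerHalf.length * packet (mainTile ξ J.lowerHalf) x) ∧
    (∀ x ∈ J.upperHalf.toSet,
      √J.length * packet (mainTile ξ J) x
          = ε * (√J.upperHalf.length * packet (mainTile ξ J.upperHalf) x) ∧
        √J.length * packet (otherTile ξ J) x
          = -ε * (√J.upperHalf.length * packet (mainTile ξ J.upperHalf) x)) := by
  have hd := disjoint_halves J
  have hcl : cell (-J.lowerHalf.scale) ξ = cell (-J.scale) ξ / 2 := by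
    rw [← cell_one_sub]; simp only [DyadicInterval.lowerHalf]; congr 1; ring
  have hcu : cell (-J.upperHalf.scale) ξ = cell (-J.scale) ξ / 2 := by
    rw [← cell_one_sub]; simp only [DyadicInterval.upperHalf]; congr 1; ring
  rw [length_lowerHalf, length_upperHalf]
  unfold mainTile otherTile
  rw [hcl, hcu]
  generalize cell (-J.scale) ξ = n
  obtain ⟨a, b, hb, rfl⟩ : ∃ a b, b < 2 ∧ n = 2 * a + b := ⟨n / 2, n % 2, by omega, by omega⟩
  have hsib : sibling (2 * a + b) = 2 * a + (1 - b) := by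
    unfold sibling; split_ifs <;> omega
  have hsgn : ((-1 : ℝ)) ^ (1 - b) = -(-1) ^ b := by interval_cases b <;> simp
  rw [hsib, show (2 * a + b) / 2 = a by omega]
  refine ⟨(-1) ^ b, by rw [← pow_mul, mul_comm, pow_mul]; simp, fun x hx => ?_, fun x hx => ?_⟩
  · have h0 : packet (mkTile J.upperHalf a) x = 0 :=
      packet_of_notMem (Set.disjoint_left.1 hd hx)
    rw [sqrt_mul_packet_half hb, sqrt_mul_packet_half (by omega : 1 - b < 2), h0]
    simp
  · have h0 : packet (mkTile J.lowerHalf a) x = 0 :=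
      packet_of_notMem (Set.disjoint_right.1 hd hx)
    rw [sqrt_mul_packet_half hb, sqrt_mul_packet_half (by omega : 1 - b < 2), h0, hsgn]
    simp

section JumpCount

variable {f : ℝ → ℝ} {ξ : ℝ} {N : Finset DyadicInterval} {s lam : ℝ}

/-- One step of the induction below: passing from `J` to one of its halves `K`. -/
lemma lintegral_jumps_half (hs : 0 < s)
    (hmass : ∀ J, mass f ξ N J ≤ s ^ 2 * J.length) {d : ℕ}
    (ih : ∀ (K : DyadicInterval) (t : ℝ),
      ∫⁻ x in K.toSet, ENNReal.ofReal (1 + lam ^ 2 / (2 * s ^ 2)) ^ (greedy lam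
        (path f ξ N K.scale x) (t * (√K.length * packet (mainTile ξ K) x)) d).1
      ≤ ENNReal.ofReal (K.length + (mass f ξ N K + K.length * t ^ 2) / s ^ 2))
    {J K : DyadicInterval} (hKJ : K.toSet ⊆ J.toSet) (hK : K.scale = J.scale - 1) (t t' : ℝ)
    (ht : ∀ x ∈ K.toSet, t * (√J.length * packet (mainTile ξ J) x) + increment f ξ N J x
      = t' * (√K.length * packet (mainTile ξ K) x)) (hlam : 0 ≤ lam) :
    ∫⁻ x in K.toSet, ENNReal.ofReal (1 + lam ^ 2 / (2 * s ^ 2)) ^ (greedy lam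
        (path f ξ N J.scale x) (t * (√J.length * packet (mainTile ξ J) x)) (d + 1)).1
      ≤ ENNReal.ofReal (K.length + (mass f ξ N K + K.length * t' ^ 2) / s ^ 2) := by
  have hstep : ∀ x ∈ K.toSet,
      t * (√J.length * packet (mainTile ξ J) x) + path f ξ N J.scale x 0
        = t' * (√K.length * packet (mainTile ξ K) x) := by
    intro x hx
    rw [← ht x hx, path, Nat.cast_zero, sub_zero, ← eq_dyad_of_mem (hKJ hx)]
  have hshift : ∀ x, (fun i => path f ξ N J.scale x (i + 1)) = path f ξ N K.scale x := by
    intro x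
    ext i
    unfold path
    rw [hK]
    congr 2
    push_cast; ring
  have habs : ∀ x ∈ K.toSet,
      |t * (√J.length * packet (mainTile ξ J) x) + path f ξ N J.scale x 0| = |t'| := by
    intro x hx
    rw [hstep x hx, abs_mul]
    have := abs_sqrt_mul_packet (p := mainTile ξ K) hx
    change |√K.length * packet (mainTile ξ K) x| = 1 at this
    rw [this, mul_one]
  have hL := length_pos K
  have hM := mass_nonneg f ξ N K
  by_cases hj : lam ≤ |t'|
  · have h1 : ∀ x ∈ K.toSet, ENNReal.ofReal (1 + lam ^ 2 / (2 * s ^ 2)) ^ (greedy lam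
        (path f ξ N J.scale x) (t * (√J.length * packet (mainTile ξ J) x)) (d + 1)).1
        = ENNReal.ofReal (1 + lam ^ 2 / (2 * s ^ 2)) *
          ENNReal.ofReal (1 + lam ^ 2 / (2 * s ^ 2)) ^ (greedy lam
        (path f ξ N K.scale x) (0 * (√K.length * packet (mainTile ξ K) x)) d).1 := by
      intro x hx
      rw [greedy_succ_of_le (by rw [habs x hx]; exact hj), hshift, pow_succ, mul_comm, zero_mul]
    rw [setLIntegral_congr_fun (measurableSet_toSet K) h1,
      lintegral_const_mul' _ _ ENNReal.ofReal_ne_top]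
    refine (mul_le_mul_right (ih K 0) _).trans ?_
    rw [← ENNReal.ofReal_mul (by positivity)]
    refine ENNReal.ofReal_le_ofReal ?_
    have h2 : lam ^ 2 ≤ t' ^ 2 := by
      rw [← sq_abs t']; exact pow_le_pow_left₀ hlam hj 2
    have h3 := hmass K
    have h4 : mass f ξ N K / s ^ 2 ≤ K.length := by
      rw [div_le_iff₀ (by positivity), mul_comm]; exact h3
    have h5 : lam ^ 2 / (2 * s ^ 2) * (K.length + mass f ξ N K / s ^ 2)
        ≤ lam ^ 2 / (2 * s ^ 2) * (2 * K.length) :=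
      mul_le_mul_of_nonneg_left (by linarith) (by positivity)
    have h6 : lam ^ 2 / (2 * s ^ 2) * (2 * K.length) ≤ K.length * t' ^ 2 / s ^ 2 := by
      rw [div_mul_eq_mul_div, div_le_div_iff₀ (by positivity) (by positivity)]
      nlinarith [mul_le_mul_of_nonneg_left h2 (by positivity : 0 ≤ K.length * s ^ 2)]
    calc (1 + lam ^ 2 / (2 * s ^ 2)) * (K.length + (mass f ξ N K + K.length * 0 ^ 2) / s ^ 2)
        = K.length + mass f ξ N K / s ^ 2
          + lam ^ 2 / (2 * s ^ 2) * (K.length + mass f ξ N K / s ^ 2) := by ring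
      _ ≤ K.length + mass f ξ N K / s ^ 2 + K.length * t' ^ 2 / s ^ 2 := by linarith
      _ = _ := by ring
  · have h1 : ∀ x ∈ K.toSet, ENNReal.ofReal (1 + lam ^ 2 / (2 * s ^ 2)) ^ (greedy lam
        (path f ξ N J.scale x) (t * (√J.length * packet (mainTile ξ J) x)) (d + 1)).1
        = ENNReal.ofReal (1 + lam ^ 2 / (2 * s ^ 2)) ^ (greedy lam
        (path f ξ N K.scale x) (t' * (√K.length * packet (mainTile ξ K) x)) d).1 := by
      intro x hx
      rw [greedy_succ_of_lt (by rw [habs x hx]; exact not_le.1 hj), hshift, hstep x hx]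
    rw [setLIntegral_congr_fun (measurableSet_toSet K) h1]
    exact ih K t'

/-- The key estimate. The right-hand side is linear in the conditional second moment
`(mass + length * t ^ 2) / length` of the remaining martingale, measured from the anchor. This
quantity is a martingale along the dyadic intervals, except that it drops by at least `lam ^ 2` at
each jump, which pays for a factor `1 + lam ^ 2 / (2 * s ^ 2)`. -/
lemma lintegral_jumps_le (hs : 0 < s) (hlam : 0 ≤ lam)
    (hmass : ∀ J, mass f ξ N J ≤ s ^ 2 * J.length) (d : ℕ) (J : DyadicInterval) (t : ℝ) :
    ∫⁻ x in J.toSet, ENNReal.ofReal (1 + lam ^ 2 / (2 * s ^ 2)) ^ (greedy lam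
        (path f ξ N J.scale x) (t * (√J.length * packet (mainTile ξ J) x)) d).1
      ≤ ENNReal.ofReal (J.length + (mass f ξ N J + J.length * t ^ 2) / s ^ 2) := by
  classical
  induction d generalizing J t with
  | zero =>
    simp only [greedy, pow_zero, lintegral_const, one_mul, Measure.restrict_apply_univ,
      volume_toSet]
    refine ENNReal.ofReal_le_ofReal ?_
    have := mass_nonneg f ξ N J
    have := length_pos J
    have : 0 ≤ (mass f ξ N J + J.length * t ^ 2) / s ^ 2 := by positivity
    linarith
  | succ d ih =>
    have hJ := length_pos J
    obtain ⟨ε, hε, hl, hu⟩ := exists_sign ξ J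
    obtain ⟨b, hb, hb2⟩ : ∃ b : ℝ,
        (∀ x, increment f ξ N J x = b * (√J.length * packet (otherTile ξ J) x)) ∧
        J.length * b ^ 2 = if J ∈ N then coef f (otherTile ξ J) ^ 2 else 0 := by
      have hsq := Real.sqrt_pos.2 hJ
      by_cases hN : J ∈ N
      · refine ⟨coef f (otherTile ξ J) / √J.length, fun x => ?_, ?_⟩
        · simp only [increment, hN, if_true]; field_simp
        · rw [if_pos hN, div_pow, Real.sq_sqrt hJ.le]; field_simp
      · exact ⟨0, fun x => by simp [increment, hN], by simp [hN]⟩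
    have h1 := lintegral_jumps_half hs hmass (lam := lam) ih (lowerHalf_subset J) rfl t (t + b)
      (fun x hx => by rw [hb, (hl x hx).1, (hl x hx).2]; ring) hlam
    have h2 := lintegral_jumps_half hs hmass (lam := lam) ih (upperHalf_subset J) rfl t
      (ε * (t - b)) (fun x hx => by rw [hb, (hu x hx).1, (hu x hx).2]; ring) hlam
    have hm := mass_halves_le f ξ N J
    have hml := mass_nonneg f ξ N J.lowerHalf
    have hmu := mass_nonneg f ξ N J.upperHalf
    have hul : ∀ g : ℝ → ℝ≥0∞, ∫⁻ x in J.toSet, g x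
        = (∫⁻ x in J.lowerHalf.toSet, g x) + ∫⁻ x in J.upperHalf.toSet, g x := fun g => by
      rw [toSet_eq_union J, lintegral_union (measurableSet_toSet _) (disjoint_halves J)]
    rw [hul]
    refine (add_le_add h1 h2).trans ?_
    rw [length_lowerHalf, length_upperHalf, ← ENNReal.ofReal_add (by positivity) (by positivity)]
    refine ENNReal.ofReal_le_ofReal ?_
    have h3 : (ε * (t - b)) ^ 2 = (t - b) ^ 2 := by rw [mul_pow, hε, one_mul]
    rw [h3]
    calc _ = J.length + (mass f ξ N J.lowerHalf + mass f ξ N J.upperHalf + J.length * b ^ 2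
          + J.length * t ^ 2) / s ^ 2 := by ring
      _ ≤ _ := by rw [hb2]; gcongr

end JumpCount

/-! ### Variation norms and jump counts -/

lemma sum_edist_le_eVariationOn (ψ : ℝ → ℝ) {n : ℕ} {ξ : Fin (n + 1) → ℝ} (hξ : StrictMono ξ)
    (h0 : ∀ i, 0 ≤ ξ i) : ∑ i : Fin n, edist (ψ (ξ i.succ)) (ψ (ξ i.castSucc))
      ≤ eVariationOn ψ (Ici 0) := by
  let u : ℕ → ℝ := fun i => ξ ⟨min i n, by omega⟩
  have hu : Monotone u := fun i j hij => hξ.monotone (by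
    rw [Fin.le_def]; exact min_le_min_right n hij)
  refine le_trans (le_of_eq ?_) (eVariationOn.sum_le (f := ψ) (s := Ici 0) (n := n) hu
    fun i => h0 _)
  rw [Finset.sum_range]
  refine Finset.sum_congr rfl fun i _ => ?_
  have h1 : u (i + 1) = ξ i.succ := by
    simp only [u]; congr 1; ext; simp
  have h2 : u i = ξ i.castSucc := by
    simp only [u]; congr 1; ext; simp
  rw [h1, h2]

/-- Control of the variation norm by jump counts at the dyadic levels `2 ^ (-j) * s`. Increments of
size at most `4 * s` are sorted by their size, and an increment larger than `2 * 2 ^ (-j) * s`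
changes the counter `ψ` of level `j`; larger increments are controlled by the counter of level
`0`. -/
lemma variationNorm_le {r s : ℝ} (hr : 1 ≤ r) (hs : 0 < s) (m : ℝ → ℝ) (V : ℕ → ℕ)
    (hsup : ∀ ξ, 0 ≤ ξ → |m ξ| ≤ 2 * s + 2 * s * V 0)
    (hV : ∀ j, ∃ ψ : ℝ → ℕ, eVariationOn (fun ξ => (ψ ξ : ℝ)) (Ici 0) ≤ V j ∧
      ∀ ξ η, 0 ≤ ξ → 0 ≤ η →
        |m ξ - m η| ≤ 2 * ((1 / 2) ^ j * s) + 2 * s * |(ψ ξ : ℝ) - ψ η|) :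
    variationNorm r m ≤ ENNReal.ofReal (2 * s + 2 * s * V 0)
      + ENNReal.ofReal (4 * s) *
        ((V 0 : ℝ≥0∞) ^ r + ∑' j, ((2⁻¹ : ℝ≥0∞) ^ j) ^ r * V j) ^ (1 / r) := by
  have hr0 : 0 < r := by linarith
  choose ψ hψV hψ using hV
  unfold variationNorm
  refine add_le_add ?_ ?_
  · rw [eLpNorm_exponent_top]
    refine eLpNormEssSup_le_of_ae_bound ?_
    filter_upwards [(ae_restrict_mem measurableSet_Ici : ∀ᵐ x ∂halfLine, x ∈ Ici (0 : ℝ))]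
      with ξ hξ
    exact hsup ξ hξ
  refine iSup_le fun n => iSup_le fun ξ => iSup_le fun hmono => iSup_le fun hξ0 => ?_
  have hinc : ∀ x y, 0 ≤ x → 0 ≤ y → ‖m x - m y‖ₑ ^ r ≤ ENNReal.ofReal (4 * s) ^ r *
      ((V 0 : ℝ≥0∞) ^ (r - 1) * edist (ψ 0 x : ℝ) (ψ 0 y)
        + ∑' j, ((2⁻¹ : ℝ≥0∞) ^ j) ^ r * edist (ψ j x : ℝ) (ψ j y)) := by
    intro x y hx hy
    rw [Real.enorm_eq_ofReal_abs]
    rcases eq_or_lt_of_le (abs_nonneg (m x - m y)) with h0 | hpos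
    · rw [← h0]; simp [hr0]
    rcases le_or_gt |m x - m y| (4 * s) with hle | hgt
    · obtain ⟨j, hj1, hj2⟩ := exists_nat_pow_near_of_lt_one (x := |m x - m y| / (4 * s))
        (y := 1 / 2) (by positivity) (by rw [div_le_one (by positivity)]; exact hle)
        (by norm_num) (by norm_num)
      rw [lt_div_iff₀ (by positivity)] at hj1
      rw [div_le_iff₀ (by positivity)] at hj2
      have hne : ψ j x ≠ ψ j y := by
        intro h
        have := hψ j x y hx hy
        rw [h, sub_self, abs_zero, mul_zero, add_zero] at this
        rw [pow_succ] at hj1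
        linarith
      have h1 : 1 ≤ edist (ψ j x : ℝ) (ψ j y) := by
        rw [edist_dist, Real.dist_eq, ENNReal.one_le_ofReal]
        have : (1 : ℤ) ≤ |(ψ j x : ℤ) - ψ j y| := by
          apply Int.one_le_abs; omega
        exact_mod_cast this
      calc ENNReal.ofReal |m x - m y| ^ r
          ≤ (ENNReal.ofReal (4 * s) * (2⁻¹ : ℝ≥0∞) ^ j) ^ r := by
            refine ENNReal.rpow_le_rpow ?_ hr0.le
            refine (ENNReal.ofReal_le_ofReal hj2).trans_eq ?_
            rw [mul_comm, ENNReal.ofReal_mul (by positivity), ENNReal.ofReal_pow (by norm_num)]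
            congr 2
            rw [one_div, ENNReal.ofReal_inv_of_pos two_pos]
            simp
        _ = ENNReal.ofReal (4 * s) ^ r * (((2⁻¹ : ℝ≥0∞) ^ j) ^ r * 1) := by
            rw [ENNReal.mul_rpow_of_nonneg _ _ hr0.le, mul_one]
        _ ≤ _ := by
            refine mul_le_mul_right ?_ _
            refine le_trans ?_ le_add_self
            refine le_trans (mul_le_mul_right h1 _) ?_
            exact ENNReal.le_tsum (f := fun j => ((2⁻¹ : ℝ≥0∞) ^ j) ^ r *
              edist (ψ j x : ℝ) (ψ j y)) j
    · have h1 := hψ 0 x y hx hy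
      rw [pow_zero, one_mul] at h1
      have h2 : |m x - m y| ≤ 4 * s * |(ψ 0 x : ℝ) - ψ 0 y| := by linarith
      have h3 : ENNReal.ofReal |m x - m y|
          ≤ ENNReal.ofReal (4 * s) * edist (ψ 0 x : ℝ) (ψ 0 y) := by
        rw [edist_dist, Real.dist_eq, ← ENNReal.ofReal_mul (by positivity)]
        exact ENNReal.ofReal_le_ofReal h2
      have h4 : edist (ψ 0 x : ℝ) (ψ 0 y) ≤ V 0 :=
        (eVariationOn.edist_le (fun ξ => (ψ 0 ξ : ℝ)) (s := Ici 0) hx hy).trans (hψV 0)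
      calc ENNReal.ofReal |m x - m y| ^ r
          ≤ (ENNReal.ofReal (4 * s) * edist (ψ 0 x : ℝ) (ψ 0 y)) ^ r :=
            ENNReal.rpow_le_rpow h3 hr0.le
        _ = ENNReal.ofReal (4 * s) ^ r *
            (edist (ψ 0 x : ℝ) (ψ 0 y) ^ (r - 1) * edist (ψ 0 x : ℝ) (ψ 0 y)) := by
            rw [ENNReal.mul_rpow_of_nonneg _ _ hr0.le]
            congr 1
            nth_rw 3 [← ENNReal.rpow_one (edist (ψ 0 x : ℝ) (ψ 0 y))]
            rw [← ENNReal.rpow_add_of_nonneg _ _ (by linarith) zero_le_one, sub_add_cancel]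
        _ ≤ _ := by
            refine mul_le_mul_right (le_trans ?_ le_self_add) _
            exact mul_le_mul_left (ENNReal.rpow_le_rpow h4 (by linarith)) _
  have hsum : ∑ i : Fin n, ‖m (ξ i.succ) - m (ξ i.castSucc)‖ₑ ^ r ≤ ENNReal.ofReal (4 * s) ^ r *
      ((V 0 : ℝ≥0∞) ^ r + ∑' j, ((2⁻¹ : ℝ≥0∞) ^ j) ^ r * V j) := by
    have hV' : ∀ j, ∑ i : Fin n, edist (ψ j (ξ i.succ) : ℝ) (ψ j (ξ i.castSucc)) ≤ V j := fun j =>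
      (sum_edist_le_eVariationOn (fun x => (ψ j x : ℝ)) hmono hξ0).trans (hψV j)
    refine (Finset.sum_le_sum fun i _ => hinc _ _ (hξ0 _) (hξ0 _)).trans ?_
    rw [← Finset.mul_sum, Finset.sum_add_distrib, ← Finset.mul_sum,
      ← Summable.tsum_finsetSum fun _ _ => ENNReal.summable]
    refine mul_le_mul_right (add_le_add ?_ ?_) _
    · refine (mul_le_mul_right (hV' 0) _).trans_eq ?_
      nth_rw 2 [← ENNReal.rpow_one (V 0 : ℝ≥0∞)]
      rw [← ENNReal.rpow_add_of_nonneg _ _ (by linarith) zero_le_one, sub_add_cancel]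
    · refine ENNReal.tsum_le_tsum fun j => ?_
      rw [← Finset.mul_sum]
      exact mul_le_mul_right (hV' j) _
  refine (ENNReal.rpow_le_rpow hsum (by positivity)).trans_eq ?_
  rw [ENNReal.mul_rpow_of_nonneg _ _ (by positivity), ← ENNReal.rpow_mul,
    mul_one_div_cancel hr0.ne', ENNReal.rpow_one]

/-! ### Integration of the jump counts -/

/-- Powers are dominated by the exponential `(1 + t / 2) ^ n ≥ exp (t * n / 4)`. -/
lemma rpow_le_mul_one_add_pow {p t : ℝ} (hp : 0 < p) (ht0 : 0 ≤ t) (ht1 : t ≤ 1) (n : ℕ) :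
    (t * (2 * n + 2)) ^ p ≤ (8 * p) ^ p * Real.exp (1 / 4) * (1 + t / 2) ^ n := by
  have h1 : Real.exp (t / 4) ≤ 1 + t / 2 := by
    have h2 : 1 - t / 4 ≤ Real.exp (-(t / 4)) := by
      have := Real.add_one_le_exp (-(t / 4)); linarith
    have h3 : Real.exp (t / 4) * Real.exp (-(t / 4)) = 1 := by rw [← Real.exp_add]; simp
    have h4 := Real.exp_pos (t / 4)
    have h5 : Real.exp (t / 4) * (1 - t / 4) ≤ 1 :=
      (mul_le_mul_of_nonneg_left h2 h4.le).trans_eq h3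
    by_contra hcon
    push Not at hcon
    have h6 : (1 + t / 2) * (1 - t / 4) < Real.exp (t / 4) * (1 - t / 4) :=
      mul_lt_mul_of_pos_right hcon (by linarith)
    nlinarith
  have h2 : Real.exp (t * n / 4) ≤ (1 + t / 2) ^ n := by
    rw [show t * n / 4 = n * (t / 4) by ring, Real.exp_nat_mul]
    exact pow_le_pow_left₀ (Real.exp_pos _).le h1 n
  have h3 : t * (2 * n + 2) ≤ 8 * p * Real.exp (t * (2 * n + 2) / (8 * p)) := by
    have h4 := Real.add_one_le_exp (t * (2 * n + 2) / (8 * p))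
    have h5 : t * (2 * n + 2) = 8 * p * (t * (2 * n + 2) / (8 * p)) := by field_simp
    calc t * (2 * n + 2) = 8 * p * (t * (2 * n + 2) / (8 * p)) := h5
      _ ≤ _ := mul_le_mul_of_nonneg_left (by linarith) (by positivity)
  calc (t * (2 * n + 2)) ^ p ≤ (8 * p * Real.exp (t * (2 * n + 2) / (8 * p))) ^ p :=
        Real.rpow_le_rpow (by positivity) h3 hp.le
    _ = (8 * p) ^ p * Real.exp (t * (2 * n + 2) / 8) := by
        rw [Real.mul_rpow (by positivity) (Real.exp_pos _).le, ← Real.exp_mul]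
        congr 2
        field_simp
    _ ≤ (8 * p) ^ p * (Real.exp (1 / 4) * Real.exp (t * n / 4)) := by
        refine mul_le_mul_of_nonneg_left ?_ (by positivity)
        rw [← Real.exp_add]
        exact Real.exp_le_exp.2 (by linarith)
    _ ≤ _ := by
        rw [mul_assoc]
        exact mul_le_mul_of_nonneg_left
          (mul_le_mul_of_nonneg_left h2 (Real.exp_pos _).le) (by positivity)

/-- The bound of `variationNorm_le` in terms of one supremum over the levels. It uses `r > 2`, in
the form that `2 ^ (-r * j)` is the product of `4 ^ (-j)` and of a decaying weight. -/
lemma levels_le {r : ℝ} (hr : 2 < r) {ρ : ℝ≥0∞} (hρ : ρ = (2⁻¹ : ℝ≥0∞) ^ ((r - 2) / 2))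
    {s : ℝ} (hs : 0 < s) (V : ℕ → ℕ) (hV : 2 ≤ V 0) :
    ENNReal.ofReal (2 * s + 2 * s * V 0) + ENNReal.ofReal (4 * s) *
        ((V 0 : ℝ≥0∞) ^ r + ∑' j, ((2⁻¹ : ℝ≥0∞) ^ j) ^ r * V j) ^ (1 / r)
      ≤ 12 * (∑' j, ρ ^ j) * ENNReal.ofReal s * ⨆ j, ρ ^ j * (((2⁻¹ : ℝ≥0∞) ^ j) ^ 2 * V j) := by
  have hr0 : 0 < r := by linarith
  set W : ℝ≥0∞ := ∑' j, ρ ^ j with hW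
  set Z : ℝ≥0∞ := ⨆ j, ρ ^ j * (((2⁻¹ : ℝ≥0∞) ^ j) ^ 2 * V j) with hZ
  have hW1 : 1 ≤ W := (pow_zero ρ).symm.le.trans (ENNReal.le_tsum 0)
  have hVZ : (V 0 : ℝ≥0∞) ≤ Z := by
    have := le_iSup (fun j => ρ ^ j * (((2⁻¹ : ℝ≥0∞) ^ j) ^ 2 * V j)) 0
    simpa using this
  have hZ1 : 1 ≤ Z := le_trans (by exact_mod_cast (by omega : 1 ≤ V 0)) hVZ
  have hsum : ∑' j, ((2⁻¹ : ℝ≥0∞) ^ j) ^ r * V j ≤ W * Z := by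
    rw [hW, ← ENNReal.tsum_mul_right]
    refine ENNReal.tsum_le_tsum fun j => ?_
    have h1 : ((2⁻¹ : ℝ≥0∞) ^ j) ^ r = ρ ^ j * (ρ ^ j * ((2⁻¹ : ℝ≥0∞) ^ j) ^ 2) := by
      have h0 : (2⁻¹ : ℝ≥0∞) ≠ 0 := by simp
      have ht : (2⁻¹ : ℝ≥0∞) ≠ ⊤ := by simp
      have h2 : ρ ^ j = (2⁻¹ : ℝ≥0∞) ^ ((r - 2) / 2 * j) := by
        rw [hρ, ENNReal.rpow_mul, ENNReal.rpow_natCast]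
      rw [h2, ← pow_mul, ← ENNReal.rpow_natCast, ← ENNReal.rpow_natCast, ← ENNReal.rpow_mul,
        ← ENNReal.rpow_add _ _ h0 ht, ← ENNReal.rpow_add _ _ h0 ht]
      congr 1
      push_cast; ring
    rw [h1, mul_assoc, mul_assoc]
    exact mul_le_mul_right (le_iSup (fun j => ρ ^ j * (((2⁻¹ : ℝ≥0∞) ^ j) ^ 2 * V j)) j) _
  have hroot : ((V 0 : ℝ≥0∞) ^ r + ∑' j, ((2⁻¹ : ℝ≥0∞) ^ j) ^ r * V j) ^ (1 / r)
      ≤ 2 * (W * Z) := by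
    have hr1 : 1 / r ≤ 1 := by rw [div_le_one hr0]; linarith
    refine (ENNReal.rpow_add_le_add_rpow _ _ (by positivity) hr1).trans ?_
    rw [← ENNReal.rpow_mul, mul_one_div_cancel hr0.ne', ENNReal.rpow_one, two_mul]
    refine add_le_add (hVZ.trans (le_mul_of_one_le_left' hW1)) ?_
    refine (ENNReal.rpow_le_rpow hsum (by positivity)).trans ?_
    have h1 : 1 ≤ W * Z := one_le_mul hW1 hZ1
    exact (ENNReal.rpow_le_rpow_of_exponent_le h1 hr1).trans_eq (ENNReal.rpow_one _)
  have hfirst : ENNReal.ofReal (2 * s + 2 * s * V 0) ≤ ENNReal.ofReal s * (4 * (W * Z)) := by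
    have h1 : 2 * s + 2 * s * V 0 ≤ s * (4 * V 0) := by
      have : (2 : ℝ) ≤ V 0 := by exact_mod_cast hV
      nlinarith
    refine (ENNReal.ofReal_le_ofReal h1).trans ?_
    rw [ENNReal.ofReal_mul hs.le, ENNReal.ofReal_mul (by norm_num), ENNReal.ofReal_natCast]
    refine mul_le_mul_right ?_ _
    rw [ENNReal.ofReal_ofNat]
    exact mul_le_mul_right (hVZ.trans (le_mul_of_one_le_left' hW1)) _
  refine (add_le_add hfirst (mul_le_mul_right hroot _)).trans_eq ?_
  rw [mul_comm 4 s, ENNReal.ofReal_mul hs.le, ENNReal.ofReal_ofNat]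
  ring

/-- Integration of the variation bounds, given exponential integrability of the numbers of jumps at
all levels. -/
lemma exists_eLpNorm_le {p r : ℝ} (hp : 1 < p) (hr : 2 < r) :
    ∃ C : ℝ≥0, ∀ s : ℝ, 0 < s → ∀ (J : DyadicInterval) (F : ℝ → ℝ≥0∞) (n : ℕ → ℝ → ℕ),
      (∀ j, Measurable (n j)) →
      (∀ j, ∫⁻ x in J.toSet, ENNReal.ofReal (1 + (1 / 4) ^ j / 2) ^ n j x
        ≤ ENNReal.ofReal (2 * J.length)) →
      (∀ x, 0 ≤ x → x ∉ J.toSet → F x = 0) →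
      (∀ x ∈ J.toSet, F x ≤ ENNReal.ofReal (2 * s + 2 * s * (2 * n 0 x + 2 : ℕ))
        + ENNReal.ofReal (4 * s) * (((2 * n 0 x + 2 : ℕ) : ℝ≥0∞) ^ r
          + ∑' j, ((2⁻¹ : ℝ≥0∞) ^ j) ^ r * ((2 * n j x + 2 : ℕ) : ℝ≥0∞)) ^ (1 / r)) →
      eLpNorm F (ENNReal.ofReal p) halfLine
        ≤ C * ENNReal.ofReal s * ENNReal.ofReal J.length ^ (1 / p) := by
  have hp0 : 0 < p := by linarith
  obtain ⟨ρ, hρ⟩ : ∃ ρ : ℝ≥0∞, ρ = (2⁻¹ : ℝ≥0∞) ^ ((r - 2) / 2) := ⟨_, rfl⟩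
  have hρ1 : ρ < 1 := by
    rw [hρ]; exact ENNReal.rpow_lt_one (by simp) (by linarith)
  have hρp1 : ρ ^ p < 1 := ENNReal.rpow_lt_one hρ1 hp0
  have hfin : ∀ a : ℝ≥0∞, a < 1 → ∑' j : ℕ, a ^ j ≠ ⊤ := by
    intro a ha
    rw [ENNReal.tsum_geometric]
    exact ENNReal.inv_ne_top.2 (tsub_pos_of_lt ha).ne'
  set W : ℝ≥0∞ := ∑' j : ℕ, ρ ^ j with hW
  set W' : ℝ≥0∞ := ∑' j : ℕ, (ρ ^ p) ^ j with hW'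
  set K : ℝ≥0∞ := ENNReal.ofReal ((8 * p) ^ p * Real.exp (1 / 4)) with hK
  have hCfin : 12 * W * (W' * (K * 2)) ^ (1 / p) ≠ ⊤ := by
    refine ENNReal.mul_ne_top (ENNReal.mul_ne_top (by simp) (hfin ρ hρ1)) ?_
    refine ENNReal.rpow_ne_top_of_nonneg (by positivity) ?_
    exact ENNReal.mul_ne_top (hfin _ hρp1) (ENNReal.mul_ne_top ENNReal.ofReal_ne_top (by simp))
  refine ⟨(12 * W * (W' * (K * 2)) ^ (1 / p)).toNNReal, ?_⟩
  intro s hs J F n hn hexp hF0 hF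
  rw [ENNReal.coe_toNNReal hCfin]
  have hpow : ∀ x ∈ J.toSet, F x ^ p ≤ (12 * W * ENNReal.ofReal s) ^ p *
      ∑' j, (ρ ^ p) ^ j * (K * ENNReal.ofReal (1 + (1 / 4) ^ j / 2) ^ n j x) := by
    intro x hx
    have h1 := (hF x hx).trans (levels_le hr hρ hs (fun j => 2 * n j x + 2) (by simp))
    refine (ENNReal.rpow_le_rpow h1 hp0.le).trans ?_
    rw [ENNReal.mul_rpow_of_nonneg _ _ hp0.le]
    refine mul_le_mul_right ?_ _
    rw [(ENNReal.orderIsoRpow p hp0).map_iSup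
      (fun j => ρ ^ j * (((2⁻¹ : ℝ≥0∞) ^ j) ^ 2 * ((2 * n j x + 2 : ℕ) : ℝ≥0∞)))
      |> fun h => (by simpa only [ENNReal.orderIsoRpow_apply] using h :
        (⨆ j, ρ ^ j * (((2⁻¹ : ℝ≥0∞) ^ j) ^ 2 * ((2 * n j x + 2 : ℕ) : ℝ≥0∞))) ^ p
          = ⨆ j, (ρ ^ j * (((2⁻¹ : ℝ≥0∞) ^ j) ^ 2 * ((2 * n j x + 2 : ℕ) : ℝ≥0∞))) ^ p)]
    refine iSup_le fun j => ?_
    refine le_trans ?_ (ENNReal.le_tsum j)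
    rw [ENNReal.mul_rpow_of_nonneg _ _ hp0.le, ← ENNReal.rpow_natCast ρ, ← ENNReal.rpow_mul,
      mul_comm (j : ℝ) p, ENNReal.rpow_mul, ENNReal.rpow_natCast]
    refine mul_le_mul_right ?_ _
    have h2 : ((2⁻¹ : ℝ≥0∞) ^ j) ^ 2 * ((2 * n j x + 2 : ℕ) : ℝ≥0∞)
        = ENNReal.ofReal ((1 / 4) ^ j * (2 * n j x + 2)) := by
      rw [ENNReal.ofReal_mul (by positivity), ENNReal.ofReal_pow (by norm_num), ← pow_mul,
        mul_comm j 2, pow_mul]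
      congr 2
      · rw [one_div, ENNReal.ofReal_inv_of_pos (by norm_num), ← ENNReal.inv_pow]
        norm_num
      · rw [← ENNReal.ofReal_natCast]; push_cast; rfl
    rw [h2, ENNReal.ofReal_rpow_of_nonneg (by positivity) hp0.le, hK,
      ← ENNReal.ofReal_pow (by positivity), ← ENNReal.ofReal_mul (by positivity)]
    exact ENNReal.ofReal_le_ofReal (rpow_le_mul_one_add_pow hp0 (by positivity)
      (pow_le_one₀ (by norm_num) (by norm_num)) _)
  have hint : ∫⁻ x, ‖F x‖ₑ ^ p ∂halfLine
      ≤ (12 * W * ENNReal.ofReal s) ^ p * (W' * (K * 2) * ENNReal.ofReal J.length) := by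
    calc ∫⁻ x, ‖F x‖ₑ ^ p ∂halfLine
        ≤ ∫⁻ x, J.toSet.indicator (fun x => (12 * W * ENNReal.ofReal s) ^ p *
            ∑' j, (ρ ^ p) ^ j * (K * ENNReal.ofReal (1 + (1 / 4) ^ j / 2) ^ n j x)) x
            ∂halfLine := by
          refine lintegral_mono_ae ?_
          filter_upwards [(ae_restrict_mem measurableSet_Ici : ∀ᵐ x ∂halfLine, x ∈ Ici (0 : ℝ))]
            with x hx0
          by_cases hx : x ∈ J.toSet
          · rw [indicator_of_mem hx]; exact hpow x hx
          · rw [hF0 x hx0 hx]; simp [hp0]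
      _ ≤ ∫⁻ x in J.toSet, (12 * W * ENNReal.ofReal s) ^ p *
            ∑' j, (ρ ^ p) ^ j * (K * ENNReal.ofReal (1 + (1 / 4) ^ j / 2) ^ n j x) := by
          rw [lintegral_indicator (measurableSet_toSet J)]
          exact lintegral_mono' (Measure.restrict_mono le_rfl Measure.restrict_le_self) le_rfl
      _ = (12 * W * ENNReal.ofReal s) ^ p * ∑' j, (ρ ^ p) ^ j * (K *
            ∫⁻ x in J.toSet, ENNReal.ofReal (1 + (1 / 4) ^ j / 2) ^ n j x) := by
          have hmeas : ∀ j, Measurable fun x => ENNReal.ofReal (1 + (1 / 4) ^ j / 2) ^ n j x :=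
            fun j => (measurable_of_countable
              (fun k : ℕ => ENNReal.ofReal (1 + (1 / 4) ^ j / 2) ^ k)).comp (hn j)
          rw [lintegral_const_mul _ (Measurable.tsum fun j =>
            ((hmeas j).const_mul _).const_mul _), lintegral_tsum fun j =>
            (((hmeas j).const_mul _).const_mul _).aemeasurable]
          congr 1
          refine tsum_congr fun j => ?_
          rw [lintegral_const_mul _ ((hmeas j).const_mul _), lintegral_const_mul _ (hmeas j)]
      _ ≤ (12 * W * ENNReal.ofReal s) ^ p * ∑' j, (ρ ^ p) ^ j * (K *
            ENNReal.ofReal (2 * J.length)) := by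
          gcongr with j
          exact hexp j
      _ = _ := by
          rw [ENNReal.tsum_mul_right, ENNReal.ofReal_mul zero_le_two, ENNReal.ofReal_ofNat]
          ring
  rw [eLpNorm_eq_lintegral_rpow_enorm_toReal (by simpa using hp0) (by simp),
    ENNReal.toReal_ofReal hp0.le]
  refine (ENNReal.rpow_le_rpow hint (by positivity)).trans_eq ?_
  rw [ENNReal.mul_rpow_of_nonneg _ _ (by positivity), ← ENNReal.rpow_mul,
    mul_one_div_cancel hp0.ne', ENNReal.rpow_one,
    ENNReal.mul_rpow_of_nonneg _ _ (by positivity)]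
  ring

/-! ### The model sum along the dyadic intervals containing a point -/

lemma eVariationOn_le_of_monotoneOn {ψ : ℝ → ℕ} {S : Set ℝ} (h : MonotoneOn ψ S) {n : ℕ}
    (hn : ∀ x ∈ S, ψ x ≤ n) : eVariationOn (fun x => (ψ x : ℝ)) S ≤ n := by
  rw [eVariationOn.eq_biSup_inter_Icc]
  refine iSup₂_le fun ab hab => ?_
  have hm : MonotoneOn (fun x => (ψ x : ℝ)) S := fun x hx y hy hxy => Nat.cast_le.2 (h hx hy hxy)
  refine (hm.eVariationOn_eq hab.1 hab.2.1).trans_le ?_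
  rw [← ENNReal.ofReal_natCast]
  refine ENNReal.ofReal_le_ofReal ?_
  have : (ψ ab.2 : ℝ) ≤ n := Nat.cast_le.2 (hn _ hab.2.1)
  have : (0 : ℝ) ≤ ψ ab.1 := Nat.cast_nonneg _
  linarith

lemma eVariationOn_le_of_antitoneOn {ψ : ℝ → ℕ} {S : Set ℝ} (h : AntitoneOn ψ S) {n : ℕ}
    (hn : ∀ x ∈ S, ψ x ≤ n) : eVariationOn (fun x => (ψ x : ℝ)) S ≤ n := by
  have h1 := eVariationOn_le_of_monotoneOn (ψ := fun x => n - ψ x) (S := S) (n := n)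
    (fun x hx y hy hxy => by have := h hx hy hxy; simp only; omega) (fun x _ => Nat.sub_le _ _)
  have h2 : eVariationOn (fun x => ((n - ψ x : ℕ) : ℝ)) S
      = eVariationOn (fun x => (n : ℝ) - ψ x) S :=
    eVariationOn.eq_of_eqOn fun x hx => by rw [Nat.cast_sub (hn x hx)]
  rw [h2] at h1
  unfold eVariationOn at h1 ⊢
  simpa only [edist_sub_left] using h1

lemma cell_mono (n : ℤ) : Monotone (cell n) := fun x y h => by
  unfold cell
  exact Nat.floor_mono (by gcongr)

open Classical in
/-- Only the bitiles at the dyadic intervals containing `x` contribute to the model sum. -/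
lemma modelSum_eq {f : ℝ → ℝ} {B : Finset Bitile} {ξ : ℝ} (hξ : ∀ P ∈ B, ξ ∈ P.freq.toSet)
    {k : ℤ} {D : ℕ} (hk : ∀ P ∈ B, P.time.scale ≤ k) (hD : ∀ P ∈ B, k - D < P.time.scale)
    {x : ℝ} (hx : 0 ≤ x) (η : ℝ) :
    modelSum B f x η = ∑ i ∈ Finset.range D,
      if bitileAt ξ (dyad (k - i) x) ∈ B then
        coef f (bitileAt ξ (dyad (k - i) x)).lower *
          packet (bitileAt ξ (dyad (k - i) x)).lower x *
          (bitileAt ξ (dyad (k - i) x)).upper.freq.toSet.indicator 1 η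
      else 0 := by
  unfold modelSum
  simp_rw [pairing_wavePacket, wavePacket_eq_packet _ hx]
  rw [← Finset.sum_filter, ← Finset.sum_filter_of_ne (p := fun P => x ∈ P.time.toSet)]
  · refine Finset.sum_nbij' (fun P => (k - P.time.scale).toNat)
      (fun i => bitileAt ξ (dyad (k - i) x)) ?_ ?_ ?_ ?_ ?_
    · intro P hP
      rw [Finset.mem_filter] at hP
      have h1 := hk P hP.1
      have h2 := hD P hP.1
      have h3 : k - ((k - P.time.scale).toNat : ℤ) = P.time.scale := by omega
      rw [Finset.mem_filter, Finset.mem_range, h3, ← eq_dyad_of_mem hP.2,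
        ← eq_bitileAt (hξ P hP.1)]
      exact ⟨by omega, hP.1⟩
    · intro i hi
      rw [Finset.mem_filter] at hi ⊢
      exact ⟨hi.2, mem_dyad hx⟩
    · intro P hP
      rw [Finset.mem_filter] at hP
      have h1 := hk P hP.1
      have h3 : k - ((k - P.time.scale).toNat : ℤ) = P.time.scale := by omega
      rw [h3, ← eq_dyad_of_mem hP.2, ← eq_bitileAt (hξ P hP.1)]
    · intro i _
      simp only [bitileAt, dyad]
      omega
    · intro P hP
      rw [Finset.mem_filter] at hP
      have h1 := hk P hP.1
      have h3 : k - ((k - P.time.scale).toNat : ℤ) = P.time.scale := by omega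
      rw [h3, ← eq_dyad_of_mem hP.2, ← eq_bitileAt (hξ P hP.1)]
  · intro P _ hne
    by_contra hxP
    apply hne
    rw [packet_of_notMem (p := P.lower) hxP]
    ring

lemma lower_eq (ξ : ℝ) (J : DyadicInterval) :
    (bitileAt ξ J).lower = mkTile J (2 * (cell (-J.scale) ξ / 2)) := by
  rw [← cell_one_sub]
  simp only [bitileAt, Bitile.lower, DyadicInterval.lowerHalf, dyad, mkTile]
  congr 2
  ring

lemma mem_upper_freq {ξ η : ℝ} (hη : 0 ≤ η) {J : DyadicInterval} :
    η ∈ (bitileAt ξ J).upper.freq.toSet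
      ↔ cell (-J.scale) η = 2 * (cell (-J.scale) ξ / 2) + 1 := by
  rw [← cell_one_sub, mem_toSet]
  simp only [bitileAt, Bitile.upper, DyadicInterval.upperHalf, dyad, hη, true_and]
  rw [show 1 - J.scale - 1 = -J.scale by ring]

lemma mem_lower_freq {ξ η : ℝ} (hη : 0 ≤ η) {J : DyadicInterval} :
    η ∈ (bitileAt ξ J).lower.freq.toSet ↔ cell (-J.scale) η = 2 * (cell (-J.scale) ξ / 2) := by
  rw [lower_eq, mem_toSet]
  simp [mkTile, hη]

lemma abs_coef_mul_packet_le {f : ℝ → ℝ} {s : ℝ} (hs : 0 ≤ s) {q : Tile}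
    (h : coef f q ^ 2 ≤ s ^ 2 * q.time.length) (x : ℝ) : |coef f q * packet q x| ≤ s := by
  have hl := length_pos q.time
  have h1 : |coef f q| ≤ s * √q.time.length := by
    rw [← Real.sqrt_sq_eq_abs]
    refine (Real.sqrt_le_sqrt h).trans_eq ?_
    rw [Real.sqrt_mul (sq_nonneg s), Real.sqrt_sq hs]
  rw [abs_mul]
  calc _ ≤ s * √q.time.length * (√q.time.length)⁻¹ :=
        mul_le_mul h1 (abs_packet_le q x) (abs_nonneg _) (by positivity)
    _ = s := by
        rw [mul_assoc, mul_inv_cancel₀ (Real.sqrt_pos.2 hl).ne', mul_one]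

section Cases

variable {f : ℝ → ℝ} {T Tbar : Tree} {s : ℝ}

lemma abs_path_le (hf : LocallyIntegrableOn f (Ici 0) volume) (hT : IsConvex Tbar.bitiles)
    (hs : 0 ≤ s) (hsize : size Tbar.bitiles f ≤ ENNReal.ofReal s) {ξ : ℝ}
    {N : Finset DyadicInterval} (hN : ∀ I ∈ N, bitileAt ξ I ∈ Tbar.bitiles) (k : ℤ) (x : ℝ)
    (i : ℕ) : |path f ξ N k x i| ≤ s := by
  unfold path increment
  split_ifs with h
  · exact abs_coef_mul_packet_le hs
      (coef_sq_le_of_size hf hT hs hsize (hN _ h) (otherTile_subset ξ _)) x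
  · simpa using hs

lemma abs_sum_sub_sum_le {lam : ℝ} (hlam : 0 ≤ lam) (hls : lam ≤ s) {β : ℕ → ℝ}
    (hβ : ∀ i, |β i| ≤ s) (i j : ℕ) :
    |∑ l ∈ Finset.range j, β l - ∑ l ∈ Finset.range i, β l|
      ≤ 2 * lam + 2 * s * |((greedy lam β 0 j).1 : ℝ) - (greedy lam β 0 i).1| := by
  have hs : 0 ≤ s := hlam.trans hls
  rcases le_total i j with h | h
  · refine (abs_sum_Ico_le hlam hls hβ h).trans ?_
    gcongr
    exact le_abs_self _
  · rw [abs_sub_comm, abs_sub_comm ((greedy lam β 0 j).1 : ℝ)]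
    refine (abs_sum_Ico_le hlam hls hβ h).trans ?_
    gcongr
    exact le_abs_self _

open Classical in
/-- For a `u`-overlapping tree the model sum is a tail of the martingale along `x`. The index where
the tail starts is monotone on either side of the top frequency, so every jump of the martingale is
seen at most twice. -/
lemma jump_bounds_uOverlapping (hTu : T.IsUOverlapping) {N : Finset DyadicInterval}
    (hN : N = T.bitiles.image Bitile.time)
    {k : ℤ} {D : ℕ} (hk : ∀ P ∈ T.bitiles, P.time.scale ≤ k)
    (hD : ∀ P ∈ T.bitiles, k - D < P.time.scale) {x : ℝ} (hx : 0 ≤ x)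
    (hpath : ∀ i, |path f T.topFreq N k x i| ≤ s) {lam : ℝ} (hlam : 0 ≤ lam) (hls : lam ≤ s) :
    (∀ η, 0 ≤ η → |modelSum T.bitiles f x η| ≤ 2 * lam
      + 2 * s * (greedy lam (path f T.topFreq N k x) 0 D).1) ∧
    ∃ ψ : ℝ → ℕ, eVariationOn (fun η => (ψ η : ℝ)) (Ici 0)
        ≤ (2 * (greedy lam (path f T.topFreq N k x) 0 D).1 + 2 : ℕ) ∧
      ∀ η η', 0 ≤ η → 0 ≤ η' → |modelSum T.bitiles f x η - modelSum T.bitiles f x η'|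
        ≤ 2 * lam + 2 * s * |(ψ η : ℝ) - ψ η'| := by
  set ξ := T.topFreq with hξ
  set β := path f ξ N k x with hβ
  have hξ0 : 0 ≤ ξ := T.topFreq_nonneg
  have hex : ∀ η, ∃ i : ℕ, D ≤ i ∨ cell (i - k) η = cell (i - k) ξ := fun η => ⟨D, Or.inl le_rfl⟩
  let i0 : ℝ → ℕ := fun η => Nat.find (hex η)
  have hi0D : ∀ η, i0 η ≤ D := fun η => Nat.find_min' (hex η) (Or.inl le_rfl)
  have hi0 : ∀ η (i : ℕ), i < D → (i0 η ≤ i ↔ cell (i - k) η = cell (i - k) ξ) := by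
    intro η i hi
    constructor
    · intro h
      rcases Nat.find_spec (hex η) with h1 | h1
      · exact absurd (h1.trans h) (by omega)
      · have h2 : ((Nat.find (hex η) : ℕ) : ℤ) ≤ i := by exact_mod_cast h
        exact cell_eq_of_le (by omega) h1
    · exact fun h => Nat.find_min' (hex η) (Or.inr h)
  have hmodel : ∀ η, 0 ≤ η → modelSum T.bitiles f x η
      = ∑ i ∈ Finset.range D, β i - ∑ i ∈ Finset.range (i0 η), β i := by
    intro η hη
    rw [modelSum_eq T.freq_mem hk hD hx, ← Finset.sum_range_add_sum_Ico β (hi0D η),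
      add_sub_cancel_left, ← Finset.sum_filter_add_sum_filter_not (Finset.range D) (i0 η ≤ ·)]
    have hz : ∀ i ∈ Finset.range D, (if bitileAt ξ (dyad (k - i) x) ∈ T.bitiles then
        coef f (bitileAt ξ (dyad (k - i) x)).lower *
          packet (bitileAt ξ (dyad (k - i) x)).lower x *
          (bitileAt ξ (dyad (k - i) x)).upper.freq.toSet.indicator 1 η
        else 0) = if i0 η ≤ i then β i else 0 := by
      intro i hi
      rw [Finset.mem_range] at hi
      have hsc : -(dyad (k - i) x).scale = i - k := by simp [dyad]
      have hmemN : dyad (k - i) x ∈ N ↔ bitileAt ξ (dyad (k - i) x) ∈ T.bitiles := by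
        rw [hN, Finset.mem_image]
        constructor
        · rintro ⟨P, hP, hPJ⟩
          rwa [← hPJ, ← eq_bitileAt (T.freq_mem P hP)]
        · exact fun h => ⟨_, h, rfl⟩
      by_cases hmem : bitileAt ξ (dyad (k - i) x) ∈ T.bitiles
      · have hodd := (mem_upper_freq hξ0).1 (hTu _ hmem)
        rw [hsc] at hodd
        have hlow : (bitileAt ξ (dyad (k - i) x)).lower = otherTile ξ (dyad (k - i) x) := by
          rw [lower_eq, otherTile, hsc]
          congr 1
          unfold sibling
          split_ifs <;> omega
        have hβi : β i = coef f (otherTile ξ (dyad (k - i) x)) *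
            packet (otherTile ξ (dyad (k - i) x)) x := by
          rw [hβ, path, increment, if_pos (hmemN.2 hmem)]
        rw [if_pos hmem, hlow, hβi]
        by_cases hc : i0 η ≤ i
        · rw [if_pos hc, indicator_of_mem, Pi.one_apply, mul_one]
          rw [mem_upper_freq hη, hsc, (hi0 η i hi).1 hc]
          exact hodd
        · rw [if_neg hc, indicator_of_notMem, mul_zero]
          rw [mem_upper_freq hη, hsc, ← hodd]
          exact fun h => hc ((hi0 η i hi).2 h)
      · rw [if_neg hmem]
        have : β i = 0 := by rw [hβ, path, increment, if_neg (fun h => hmem (hmemN.1 h))]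
        simp [this]
    rw [Finset.sum_filter_add_sum_filter_not, Finset.sum_congr rfl hz, ← Finset.sum_filter]
    refine Finset.sum_congr ?_ fun _ _ => rfl
    ext i
    simp only [Finset.mem_filter, Finset.mem_range, Finset.mem_Ico]
    tauto
  have hS := greedy_fst_mono lam β 0
  refine ⟨fun η hη => ?_, fun η => (greedy lam β 0 (i0 η)).1, ?_, fun η η' hη hη' => ?_⟩
  · rw [hmodel η hη]
    have hs : 0 ≤ s := hlam.trans hls
    refine (abs_sum_Ico_le hlam hls hpath (hi0D η)).trans ?_
    gcongr
    have : (0 : ℝ) ≤ (greedy lam β 0 (i0 η)).1 := Nat.cast_nonneg _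
    linarith
  · have hU : Ici (0 : ℝ) = Icc 0 ξ ∪ Ici ξ := (Icc_union_Ici_eq_Ici hξ0).symm
    rw [hU, eVariationOn.union _ (x := ξ) ⟨right_mem_Icc.2 hξ0, fun _ h => h.2⟩
      ⟨self_mem_Ici, fun _ h => h⟩]
    have h1 : eVariationOn (fun η => ((greedy lam β 0 (i0 η)).1 : ℝ)) (Icc 0 ξ)
        ≤ ((greedy lam β 0 D).1 : ℕ) := by
      refine eVariationOn_le_of_antitoneOn ?_ fun η _ => hS (hi0D η)
      intro η _ η' hη' hle
      refine hS (Nat.find_mono fun i hi => hi.imp_right fun h => ?_)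
      exact le_antisymm (cell_mono _ hη'.2) (h ▸ cell_mono _ hle)
    have h2 : eVariationOn (fun η => ((greedy lam β 0 (i0 η)).1 : ℝ)) (Ici ξ)
        ≤ ((greedy lam β 0 D).1 : ℕ) := by
      refine eVariationOn_le_of_monotoneOn ?_ fun η _ => hS (hi0D η)
      intro η hη η' _ hle
      refine hS (Nat.find_mono fun i hi => hi.imp_right fun h => ?_)
      exact le_antisymm (h ▸ cell_mono _ hle) (cell_mono _ hη)
    refine (add_le_add h1 h2).trans ?_
    exact_mod_cast (by omega)
  · rw [hmodel η hη, hmodel η' hη', sub_sub_sub_cancel_left, abs_sub_comm _ ((_ : ℕ) : ℝ)]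
    exact abs_sum_sub_sum_le hlam hls hpath _ _

/-- The two halves of a bitile contribute as much to a wave packet expansion as the tile over the
half of the time interval that contains the point. -/
lemma coef_mul_packet_add (hf : LocallyIntegrableOn f (Ici 0) volume) (ξ : ℝ) {x : ℝ} (hx : 0 ≤ x)
    (k : ℤ) :
    coef f (mainTile ξ (dyad k x)) * packet (mainTile ξ (dyad k x)) x
      + coef f (otherTile ξ (dyad k x)) * packet (otherTile ξ (dyad k x)) x
      = coef f (mainTile ξ (dyad (k - 1) x)) * packet (mainTile ξ (dyad (k - 1) x)) x := by
  set J := dyad k x with hJ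
  have hxJ : x ∈ J.toSet := mem_dyad hx
  have hd := disjoint_halves J
  have hcs : cell (-(k - 1)) ξ = cell (-J.scale) ξ / 2 := by
    rw [← cell_one_sub]; simp only [hJ, dyad]; congr 1; ring
  have hK : mainTile ξ (dyad (k - 1) x) = mkTile (dyad (k - 1) x) (cell (-J.scale) ξ / 2) := by
    rw [← hcs]; rfl
  rw [hK]
  unfold mainTile otherTile
  generalize cell (-J.scale) ξ = n
  obtain ⟨a, b, hb, rfl⟩ : ∃ a b, b < 2 ∧ n = 2 * a + b := ⟨n / 2, n % 2, by omega, by omega⟩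
  have hsib : sibling (2 * a + b) = 2 * a + (1 - b) := by
    unfold sibling; split_ifs <;> omega
  have hsgn : ((-1 : ℝ)) ^ (1 - b) = -(-1) ^ b := by interval_cases b <;> simp
  have hsq : ((-1 : ℝ) ^ b) ^ 2 = 1 := by rw [← pow_mul, mul_comm, pow_mul]; simp
  have h2 := inv_sqrt_two_sq
  rw [hsib, show (2 * a + b) / 2 = a by omega, coef_mkTile_two_mul_add hf hb,
    coef_mkTile_two_mul_add hf (by omega : 1 - b < 2), packet_mkTile_two_mul_add hb,
    packet_mkTile_two_mul_add (by omega : 1 - b < 2), hsgn]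
  have hc : x ∈ J.lowerHalf.toSet ∨ x ∈ J.upperHalf.toSet := by
    rw [toSet_eq_union] at hxJ; exact hxJ
  rcases hc with h | h
  · have hKJ : dyad (k - 1) x = J.lowerHalf := (eq_dyad_of_mem h).symm
    rw [hKJ, packet_of_notMem (p := mkTile J.upperHalf a) (Set.disjoint_left.1 hd h)]
    linear_combination (2 * coef f (mkTile J.lowerHalf a) * packet (mkTile J.lowerHalf a) x) * h2
  · have hKJ : dyad (k - 1) x = J.upperHalf := (eq_dyad_of_mem h).symm
    rw [hKJ, packet_of_notMem (p := mkTile J.lowerHalf a) (Set.disjoint_right.1 hd h)]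
    linear_combination (2 * coef f (mkTile J.upperHalf a) * packet (mkTile J.upperHalf a) x) *
      (((-1 : ℝ) ^ b) ^ 2 * h2 + 1 / 2 * hsq)

lemma mainTile_lt {ξ : ℝ} (hξ : 0 ≤ ξ) {I J : DyadicInterval} (h : I.toSet ⊆ J.toSet)
    (hs : I.scale < J.scale) : mainTile ξ I < mainTile ξ J := by
  refine lt_of_le_not_ge ⟨?_, h⟩ fun h' => ?_
  · exact subset_of_mem_of_le (mem_dyad (n := -J.scale) hξ) (mem_dyad (n := -I.scale) hξ)
      (neg_le_neg hs.le)
  · have := scale_le_of_subset h'.2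
    simp only [mainTile, mkTile] at this
    omega

lemma dyad_subset_dyad {m n : ℤ} (h : m ≤ n) {x : ℝ} (hx : 0 ≤ x) :
    (dyad m x).toSet ⊆ (dyad n x).toSet := subset_of_mem_of_le (mem_dyad hx) (mem_dyad hx) h

/-- A monotone step function of the level: it is constant below `a` and above `b`, and in between it
is the increasing function `S` shifted by one. -/
lemma exists_monotone_step {S : ℕ → ℕ} (hS : Monotone S) (a b : ℕ) : ∃ Ψ : ℕ → ℕ, Monotone Ψ ∧
    (∀ i, Ψ i ≤ S b + 2) ∧ (∀ i, i < a → Ψ i = 0) ∧ (∀ i, a ≤ i → i ≤ b → Ψ i = S i + 1) ∧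
    (∀ i, a ≤ i → b < i → Ψ i = S b + 2) := by
  refine ⟨fun i => if i < a then 0 else if i ≤ b then S i + 1 else S b + 2, ?_, ?_, ?_, ?_, ?_⟩
  · intro i j hij
    have h1 := hS hij
    simp only
    split_ifs with h2 h3 h4 h5 h6 h7 h8 <;> try omega
    have := hS h5
    omega
  · intro i
    simp only
    split_ifs with h1 h2
    · omega
    · have := hS h2; omega
    · exact le_rfl
  · intro i h; simp [h]
  · intro i h h'; simp [not_lt.2 h, h']
  · intro i h h'; simp [not_lt.2 h, not_le.2 h']

open Classical in
/-- For an `l`-overlapping and `l`-convex tree, the model sum takes, on adjacent frequency intervals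
that are ordered by scale, the values of the demodulated martingale of `f` along `x`. Convexity of
the ambient tree makes the differences of these values partial sums of the path. -/
lemma jump_bounds_lOverlapping (hf : LocallyIntegrableOn f (Ici 0) volume)
    (hsub : T.bitiles ⊆ Tbar.bitiles) (hconv : IsConvex Tbar.bitiles)
    (hsize : size Tbar.bitiles f ≤ ENNReal.ofReal s)
    (hTl : T.IsLOverlapping) (hlc : IsLConvex T.bitiles) {N : Finset DyadicInterval}
    (hN : N = (Tbar.bitiles.filter fun P => T.topFreq ∈ P.freq.toSet).image Bitile.time)
    {k : ℤ} {D : ℕ} (hk : ∀ P ∈ T.bitiles, P.time.scale ≤ k)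
    (hD : ∀ P ∈ T.bitiles, k - D < P.time.scale) {x : ℝ} (hx : 0 ≤ x)
    (hpath : ∀ i, |path f T.topFreq N k x i| ≤ s) {lam : ℝ} (hlam : 0 ≤ lam) (hls : lam ≤ s) :
    (∀ η, 0 ≤ η → |modelSum T.bitiles f x η| ≤ s) ∧
    ∃ ψ : ℝ → ℕ, eVariationOn (fun η => (ψ η : ℝ)) (Ici 0)
        ≤ (2 * (greedy lam (path f T.topFreq N k x) 0 D).1 + 2 : ℕ) ∧
      ∀ η η', 0 ≤ η → 0 ≤ η' → |modelSum T.bitiles f x η - modelSum T.bitiles f x η'|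
        ≤ 2 * lam + 2 * s * |(ψ η : ℝ) - ψ η'| := by
  have hs : 0 ≤ s := hlam.trans hls
  set ξ := T.topFreq with hξ
  set β := path f ξ N k x with hβ
  have hξ0 : 0 ≤ ξ := T.topFreq_nonneg
  let α : ℕ → ℝ := fun i =>
    coef f (mainTile ξ (dyad (k - i) x)) * packet (mainTile ξ (dyad (k - i) x)) x
  let K : Finset ℕ := (Finset.range D).filter fun i => bitileAt ξ (dyad (k - i) x) ∈ T.bitiles
  have hmemK : ∀ i : ℕ, bitileAt ξ (dyad (k - i) x) ∈ T.bitiles → i ∈ K := by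
    intro i hi
    refine Finset.mem_filter.2 ⟨Finset.mem_range.2 ?_, hi⟩
    have := hD _ hi
    simp only [bitileAt, dyad] at this
    omega
  have hKmem : ∀ i ∈ K, bitileAt ξ (dyad (k - i) x) ∈ T.bitiles :=
    fun i hi => (Finset.mem_filter.1 hi).2
  have hsc : ∀ i : ℕ, -(dyad (k - i) x).scale = i - k := fun i => by simp [dyad]
  -- The lower half of the bitile is the one through `ξ` if the index of the cell of `ξ` is even.
  have hlow : ∀ i : ℕ, cell (i - k) ξ = 2 * (cell (i - k) ξ / 2) →
      (bitileAt ξ (dyad (k - i) x)).lower = mainTile ξ (dyad (k - i) x) := by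
    intro i h
    rw [lower_eq, mainTile, hsc, ← h]
  have heven : ∀ i ∈ K, cell (i - k) ξ = 2 * (cell (i - k) ξ / 2) := by
    intro i hi
    have := (mem_lower_freq hξ0).1 (hTl _ (hKmem i hi))
    rwa [hsc] at this
  have hsucc : ∀ (i : ℕ) (η : ℝ), cell (((i + 1 : ℕ) : ℤ) - k) η = cell (i - k) η / 2 := by
    intro i η
    rw [← cell_add_one]; congr 1; push_cast; ring
  -- `κ η` is the first level whose dyadic interval at `ξ` has its right endpoint beyond `η`.
  have hex : ∀ η : ℝ, ∃ i : ℕ, cell (i - k) η ≤ cell (i - k) ξ := by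
    intro η
    obtain ⟨L, hL⟩ := exists_lt_zpow η
    refine ⟨L + k.toNat, ?_⟩
    rw [cell_eq_zero_of_le (n := ((L + k.toNat : ℕ) : ℤ) - k) (by push_cast; omega) hL]
    exact Nat.zero_le _
  let κ : ℝ → ℕ := fun η => Nat.find (hex η)
  have hκmono : Monotone κ := fun η η' h =>
    Nat.find_mono fun i hi => (cell_mono _ h).trans hi
  have hκ : ∀ (η : ℝ) (i : ℕ), κ η = i + 1 ↔
      cell (i - k) ξ = 2 * (cell (i - k) ξ / 2) ∧ cell (i - k) η = cell (i - k) ξ + 1 := by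
    intro η i
    constructor
    · intro h
      have h1 : cell (((i + 1 : ℕ) : ℤ) - k) η ≤ cell (((i + 1 : ℕ) : ℤ) - k) ξ := by
        rw [← h]; exact Nat.find_spec (hex η)
      have h2 : ¬ cell (i - k) η ≤ cell (i - k) ξ :=
        Nat.find_min (hex η) (by change i < κ η; omega)
      rw [hsucc, hsucc] at h1
      omega
    · rintro ⟨h1, h2⟩
      refine (Nat.find_eq_iff (hex η)).2 ⟨?_, fun j hj hcon => ?_⟩
      · rw [hsucc, hsucc, h2]; omega
      · have h3 : ∀ l : ℕ, cell ((j + l : ℕ) - k) η ≤ cell ((j + l : ℕ) - k) ξ := by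
          intro l
          induction l with
          | zero => exact hcon
          | succ l ih => rw [← add_assoc, hsucc, hsucc]; exact Nat.div_le_div_right ih
        have h4 := h3 (i - j)
        rw [show j + (i - j) = i by omega, h2] at h4
        omega
  have hmodel : ∀ η, 0 ≤ η → modelSum T.bitiles f x η
      = ∑ i ∈ K, if κ η = i + 1 then α i else 0 := by
    intro η hη
    rw [modelSum_eq T.freq_mem hk hD hx, ← Finset.sum_filter]
    refine Finset.sum_congr rfl fun i hi => ?_
    have h1 := heven i hi
    rw [hlow i h1]
    by_cases hc : κ η = i + 1
    · rw [if_pos hc, indicator_of_mem, Pi.one_apply, mul_one]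
      rw [mem_upper_freq hη, hsc, ← h1]
      exact ((hκ η i).1 hc).2
    · rw [if_neg hc, indicator_of_notMem, mul_zero]
      rw [mem_upper_freq hη, hsc, ← h1]
      exact fun h => hc ((hκ η i).2 ⟨h1, h⟩)
  have hα : ∀ i ∈ K, |α i| ≤ s := fun i hi =>
    abs_coef_mul_packet_le hs (coef_sq_le_of_size hf hconv hs hsize (hsub (hKmem i hi))
      (mainTile_subset ξ _)) x
  have hin : ∀ η, 0 ≤ η → ∀ i ∈ K, κ η = i + 1 → modelSum T.bitiles f x η = α i := by
    intro η hη i hi h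
    rw [hmodel η hη, Finset.sum_eq_single_of_mem i hi, if_pos h]
    intro j _ hj
    rw [if_neg (by omega)]
  have hout : ∀ η, 0 ≤ η → (∀ i ∈ K, κ η ≠ i + 1) → modelSum T.bitiles f x η = 0 := by
    intro η hη h
    rw [hmodel η hη]
    exact Finset.sum_eq_zero fun i hi => if_neg (h i hi)
  have hsup : ∀ η, 0 ≤ η → |modelSum T.bitiles f x η| ≤ s := by
    intro η hη
    by_cases h : ∃ i ∈ K, κ η = i + 1
    · obtain ⟨i, hi, h⟩ := h
      rw [hin η hη i hi h]; exact hα i hi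
    · push Not at h
      rw [hout η hη h]; simpa using hs
  refine ⟨hsup, ?_⟩
  rcases K.eq_empty_or_nonempty with hK | hK
  · refine ⟨fun _ => 0, by simp [eVariationOn], fun η η' hη hη' => ?_⟩
    rw [hout η hη (by simp [hK]), hout η' hη' (by simp [hK])]
    simp [hlam]
  obtain ⟨a, haK, hamin⟩ := K.exists_min_image id hK
  obtain ⟨b, hbK, hbmax⟩ := K.exists_max_image id hK
  simp only [id] at hamin hbmax
  have hab : a ≤ b := hamin b hbK
  have hbD : b < D := Finset.mem_range.1 (Finset.mem_filter.1 hbK).1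
  -- By `l`-convexity there are no gaps between the smallest and the largest level.
  have hfill : ∀ (η : ℝ) (i : ℕ), κ η = i + 1 → a ≤ i → i ≤ b → i ∈ K := by
    intro η i hi hai hib
    rcases eq_or_lt_of_le hai with h1 | h1
    · exact h1 ▸ haK
    rcases eq_or_lt_of_le hib with h2 | h2
    · exact h2 ▸ hbK
    refine hmemK i (hlc _ _ _ (hKmem b hbK) (hKmem a haK) ?_ ?_)
    · rw [hlow b (heven b hbK), hlow i ((hκ η i).1 hi).1]
      exact mainTile_lt hξ0 (dyad_subset_dyad (by omega) hx) (by simp only [dyad]; omega)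
    · rw [hlow a (heven a haK), hlow i ((hκ η i).1 hi).1]
      exact mainTile_lt hξ0 (dyad_subset_dyad (by omega) hx) (by simp only [dyad]; omega)
  have hstep : ∀ i, a ≤ i → i ≤ b → α (i + 1) = α i + β i := by
    intro i hai hib
    have hmem : bitileAt ξ (dyad (k - i) x) ∈ Tbar.bitiles :=
      hconv _ _ _ (hsub (hKmem b hbK)) (hsub (hKmem a haK))
        (bitileAt_le hξ0 (dyad_subset_dyad (by omega) hx))
        (bitileAt_le hξ0 (dyad_subset_dyad (by omega) hx))
    have hNi : dyad (k - i) x ∈ N := by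
      rw [hN, Finset.mem_image]
      exact ⟨_, Finset.mem_filter.2 ⟨hmem, mem_dyad hξ0⟩, rfl⟩
    have h1 := coef_mul_packet_add hf ξ hx (k - i)
    have h2 : k - ((i + 1 : ℕ) : ℤ) = k - i - 1 := by push_cast; ring
    simp only [α]
    rw [h2, ← h1, hβ, path, increment, if_pos hNi]
  have hαβ : ∀ i j, a ≤ i → i ≤ j → j ≤ b →
      α j - α i = ∑ l ∈ Finset.range j, β l - ∑ l ∈ Finset.range i, β l := by
    intro i j hai hij
    induction j, hij using Nat.le_induction with
    | base => intro _; simp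
    | succ j hij ih =>
      intro hjb
      rw [hstep j (hai.trans hij) (by omega), Finset.sum_range_succ]
      linear_combination ih (by omega)
  have hαle : ∀ i j, a ≤ i → a ≤ j → i ≤ b → j ≤ b →
      |α i - α j| ≤ 2 * lam + 2 * s * |((greedy lam β 0 i).1 : ℝ) - (greedy lam β 0 j).1| := by
    intro i j hai haj hib hjb
    refine le_trans (le_of_eq ?_) (abs_sum_sub_sum_le hlam hls hpath j i)
    rcases le_total i j with h | h
    · rw [abs_sub_comm, hαβ i j hai h hjb, abs_sub_comm]
    · rw [hαβ j i haj h hib]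
  obtain ⟨Ψ, hΨm, hΨle, hΨ0, hΨ1, hΨ2⟩ :=
    exists_monotone_step (S := fun i => (greedy lam β 0 (i - 1)).1)
      (fun i j h => greedy_fst_mono lam β 0 (Nat.sub_le_sub_right h 1)) (a + 1) (b + 1)
  refine ⟨fun η => Ψ (κ η), ?_, fun η η' hη hη' => ?_⟩
  · refine eVariationOn_le_of_monotoneOn (fun η _ η' _ h => hΨm (hκmono h)) fun η _ => ?_
    have h1 := hΨle (κ η)
    have h2 : (greedy lam β 0 (b + 1 - 1)).1 ≤ (greedy lam β 0 D).1 :=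
      greedy_fst_mono lam β 0 (by omega)
    omega
  · beta_reduce
    by_cases hne : Ψ (κ η) = Ψ (κ η')
    · -- Equal counters: both points are outside, on the same side, or both are inside.
      have hcases : ∀ η, 0 ≤ η → (κ η < a + 1 ∨ b + 1 < κ η) ∧ modelSum T.bitiles f x η = 0 ∨
          ∃ i, a ≤ i ∧ i ≤ b ∧ κ η = i + 1 ∧ modelSum T.bitiles f x η = α i := by
        intro η hη
        by_cases h : κ η < a + 1 ∨ b + 1 < κ η
        · refine Or.inl ⟨h, hout η hη fun i hi hcon => ?_⟩
          have := hamin i hi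
          have := hbmax i hi
          omega
        · have h1 : κ η = (κ η - 1) + 1 := by omega
          exact Or.inr ⟨κ η - 1, by omega, by omega, h1,
            hin η hη _ (hfill η _ h1 (by omega) (by omega)) h1⟩
      rcases hcases η hη with ⟨h1, h2⟩ | ⟨i, h1, h2, h3, h4⟩ <;>
        rcases hcases η' hη' with ⟨h1', h2'⟩ | ⟨j, h1', h2', h3', h4'⟩
      · rw [h2, h2', hne]; simp [hlam]
      · exfalso
        rw [h3', hΨ1 (j + 1) (by omega) (by omega)] at hne
        have h5 := greedy_fst_mono lam β 0 (show j + 1 - 1 ≤ b + 1 - 1 by omega)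
        simp only at h5
        rcases h1 with h1 | h1
        · rw [hΨ0 _ h1] at hne; omega
        · rw [hΨ2 _ (by omega) h1] at hne; omega
      · exfalso
        rw [h3, hΨ1 (i + 1) (by omega) (by omega)] at hne
        have h5 := greedy_fst_mono lam β 0 (show i + 1 - 1 ≤ b + 1 - 1 by omega)
        simp only at h5
        rcases h1' with h1' | h1'
        · rw [hΨ0 _ h1'] at hne; omega
        · rw [hΨ2 _ (by omega) h1'] at hne; omega
      · rw [h4, h4', h3, h3', hΨ1 (i + 1) (by omega) (by omega), hΨ1 (j + 1) (by omega) (by omega)]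
        have := hαle i j h1 h1' h2 h2'
        push_cast
        simpa using this
    · have h1 : (1 : ℝ) ≤ |(Ψ (κ η) : ℝ) - Ψ (κ η')| := by
        have : (1 : ℤ) ≤ |(Ψ (κ η) : ℤ) - Ψ (κ η')| := by
          apply Int.one_le_abs; omega
        exact_mod_cast this
      have h2 := abs_sub (modelSum T.bitiles f x η) (modelSum T.bitiles f x η')
      have h3 := hsup η hη
      have h4 := hsup η' hη'
      nlinarith

/-! ### The tree estimate -/

lemma measurable_path (f : ℝ → ℝ) (ξ : ℝ) (N : Finset DyadicInterval) (k : ℤ) (i : ℕ) :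
    Measurable fun x => path f ξ N k x i := by
  have h : Measurable fun q : ℕ × ℝ => increment f ξ N ⟨k - i, q.1⟩ q.2 := by
    refine measurable_from_prod_countable_right fun n => ?_
    unfold increment
    dsimp only
    split_ifs
    · exact (measurable_packet _).const_mul _
    · exact measurable_const
  exact h.comp ((measurable_cell (k - i)).prodMk measurable_id)

lemma measurable_greedy {lam : ℝ} {β : ℝ → ℕ → ℝ} (hβ : ∀ i, Measurable fun x => β x i) (i : ℕ) :
    Measurable fun x => greedy lam (β x) 0 i := by
  induction i with
  | zero => exact measurable_const
  | succ i ih =>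
    simp only [greedy]
    refine Measurable.ite ?_ ?_ ?_
    · exact measurableSet_le measurable_const (ih.snd.add (hβ i)).abs
    · exact ((measurable_of_countable (· + 1)).comp ih.fst).prodMk measurable_const
    · exact ih.fst.prodMk (ih.snd.add (hβ i))

lemma variationNorm_zero {r : ℝ} (hr : 0 < r) : variationNorm r (fun _ => 0) = 0 := by
  unfold variationNorm
  rw [eLpNorm_zero']
  simp [hr]

open Classical in
/-- The tree estimate with a positive upper bound `s` for the size. -/
lemma exists_tree_estimate {p r : ℝ} (hp : 1 < p) (hr : 2 < r) :
    ∃ C : ℝ≥0, ∀ f : ℝ → ℝ, LocallyIntegrableOn f (Ici 0) volume →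
      ∀ T Tbar : Tree, T.bitiles ⊆ Tbar.bitiles → IsConvex Tbar.bitiles →
        T.IsUOverlapping ∨ (T.IsLOverlapping ∧ IsLConvex T.bitiles) →
        ∀ s : ℝ, 0 < s → size Tbar.bitiles f ≤ ENNReal.ofReal s →
        eLpNorm (fun x => variationNorm r (fun ξ => modelSum T.bitiles f x ξ))
            (ENNReal.ofReal p) halfLine
          ≤ C * ENNReal.ofReal s * Tbar.topLength ^ (1 / p) := by
  obtain ⟨C, hC⟩ := exists_eLpNorm_le hp hr
  refine ⟨C, fun f hf T Tbar hsub hconv hT s hs hsize => ?_⟩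
  set J := Tbar.topTime with hJ
  have hJl := length_pos J
  obtain ⟨D, hD⟩ : ∃ D : ℕ, ∀ P ∈ T.bitiles, J.scale - D < P.time.scale := by
    refine ⟨T.bitiles.sup (fun P => (J.scale - P.time.scale).toNat) + 1, fun P hP => ?_⟩
    have h : (J.scale - P.time.scale).toNat ≤ _ :=
      Finset.le_sup (f := fun P : Bitile => (J.scale - P.time.scale).toNat) hP
    omega
  have hk : ∀ P ∈ T.bitiles, P.time.scale ≤ J.scale := fun P hP =>
    scale_le_of_subset (Tbar.time_subset P (hsub hP))
  -- The set of active intervals and the jump bounds, in either case.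
  obtain ⟨N, hN, hjump⟩ : ∃ N : Finset DyadicInterval,
      (∀ I ∈ N, bitileAt T.topFreq I ∈ Tbar.bitiles) ∧
      ∀ x, 0 ≤ x → ∀ lam, 0 ≤ lam → lam ≤ s →
        (∀ η, 0 ≤ η → |modelSum T.bitiles f x η| ≤ 2 * s
          + 2 * s * (2 * (greedy s (path f T.topFreq N J.scale x) 0 D).1 + 2 : ℕ)) ∧
        ∃ ψ : ℝ → ℕ, eVariationOn (fun η => (ψ η : ℝ)) (Ici 0)
            ≤ (2 * (greedy lam (path f T.topFreq N J.scale x) 0 D).1 + 2 : ℕ) ∧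
          ∀ η η', 0 ≤ η → 0 ≤ η' → |modelSum T.bitiles f x η - modelSum T.bitiles f x η'|
            ≤ 2 * lam + 2 * s * |(ψ η : ℝ) - ψ η'| := by
    rcases hT with hTu | ⟨hTl, hlc⟩
    · have hN : ∀ I ∈ T.bitiles.image Bitile.time, bitileAt T.topFreq I ∈ Tbar.bitiles := by
        intro I hI
        obtain ⟨P, hP, rfl⟩ := Finset.mem_image.1 hI
        rw [← eq_bitileAt (T.freq_mem P hP)]
        exact hsub hP
      refine ⟨_, hN, fun x hx lam hlam hls => ?_⟩
      have hpath := abs_path_le hf hconv hs.le hsize hN J.scale x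
      refine ⟨fun η hη => ?_, (jump_bounds_uOverlapping hTu rfl hk hD hx hpath hlam hls).2⟩
      refine ((jump_bounds_uOverlapping hTu rfl hk hD hx hpath hs.le le_rfl).1 η hη).trans ?_
      gcongr
      omega
    · have hN : ∀ I ∈ (Tbar.bitiles.filter fun P => T.topFreq ∈ P.freq.toSet).image Bitile.time,
          bitileAt T.topFreq I ∈ Tbar.bitiles := by
        intro I hI
        obtain ⟨P, hP, rfl⟩ := Finset.mem_image.1 hI
        rw [Finset.mem_filter] at hP
        rw [← eq_bitileAt hP.2]
        exact hP.1
      refine ⟨_, hN, fun x hx lam hlam hls => ?_⟩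
      have hpath := abs_path_le hf hconv hs.le hsize hN J.scale x
      have h1 := jump_bounds_lOverlapping hf hsub hconv hsize hTl hlc rfl hk hD hx hpath hlam hls
      refine ⟨fun η hη => (h1.1 η hη).trans ?_, h1.2⟩
      have : 0 ≤ 2 * s * ((2 * (greedy s (path f T.topFreq ((Tbar.bitiles.filter
        fun P => T.topFreq ∈ P.freq.toSet).image Bitile.time) J.scale x) 0 D).1 + 2 : ℕ) : ℝ) := by
        positivity
      linarith
  have hmass : ∀ I, mass f T.topFreq N I ≤ s ^ 2 * I.length := fun I =>
    sum_coef_otherTile_sq_le hf hconv hs.le hsize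
      (fun I' hI' => hN I' (Finset.mem_filter.1 hI').1) (fun I' hI' => (Finset.mem_filter.1 hI').2)
  refine hC s hs J _ (fun j x => (greedy ((1 / 2) ^ j * s) (path f T.topFreq N J.scale x) 0 D).1)
    (fun j => (measurable_greedy (measurable_path f T.topFreq N J.scale) D).fst) (fun j => ?_)
    (fun x hx0 hxJ => ?_) (fun x hxJ => ?_)
  · have h1 := lintegral_jumps_le hs (lam := (1 / 2) ^ j * s) (by positivity) hmass D J 0
    have h2 : ((1 / 2 : ℝ) ^ j * s) ^ 2 / (2 * s ^ 2) = (1 / 4) ^ j / 2 := by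
      rw [mul_pow, ← pow_mul, mul_comm j 2, pow_mul]
      field_simp
      norm_num
    rw [h2] at h1
    simp only [zero_mul] at h1
    refine h1.trans (ENNReal.ofReal_le_ofReal ?_)
    have h3 : mass f T.topFreq N J / s ^ 2 ≤ J.length := by
      rw [div_le_iff₀ (by positivity), mul_comm]; exact hmass J
    calc J.length + (mass f T.topFreq N J + J.length * 0 ^ 2) / s ^ 2
        = J.length + mass f T.topFreq N J / s ^ 2 := by ring
      _ ≤ _ := by linarith
  · have h0 : (fun η => modelSum T.bitiles f x η) = fun _ => 0 := by
      ext η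
      refine Finset.sum_eq_zero fun P hP => ?_
      rw [wavePacket_eq_packet _ hx0, packet_of_notMem (p := P.lower)
        (fun h => hxJ (Tbar.time_subset P (hsub hP) h))]
      ring
    rw [h0]
    exact variationNorm_zero (by linarith)
  · have hx0 := nonneg_of_mem hxJ
    refine variationNorm_le (by linarith) hs _
      (fun j => 2 * (greedy ((1 / 2) ^ j * s) (path f T.topFreq N J.scale x) 0 D).1 + 2)
      (fun η hη => ?_) fun j => ?_
    · have := (hjump x hx0 s hs.le le_rfl).1 η hη
      simpa only [pow_zero, one_mul] using this
    · exact (hjump x hx0 ((1 / 2) ^ j * s) (by positivity)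
        (mul_le_of_le_one_left hs.le (pow_le_one₀ (by norm_num) (by norm_num)))).2

end Cases

end WalshModel

theorem lemma5p1 (p r : ℝ) (hp : 1 < p) (hr : 2 < r) :
    ∃ C : ℝ≥0, ∀ f : ℝ → ℝ, LocallyIntegrableOn f (Ici 0) volume →
      ∀ T Tbar : WalshModel.Tree, T.bitiles ⊆ Tbar.bitiles → WalshModel.IsConvex Tbar.bitiles →
        T.IsUOverlapping ∨ (T.IsLOverlapping ∧ WalshModel.IsLConvex T.bitiles) →
        eLpNorm (fun x => WalshModel.variationNorm r (fun ξ => WalshModel.modelSum T.bitiles f x ξ))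
            (ENNReal.ofReal p) WalshModel.halfLine
          ≤ C * WalshModel.size Tbar.bitiles f * Tbar.topLength ^ (1 / p) := by
  obtain ⟨C, hC⟩ := WalshModel.exists_tree_estimate hp hr
  -- The constant is made positive so that the right-hand side is infinite if the size is.
  refine ⟨C + 1, fun f hf T Tbar hsub hconv hT => ?_⟩
  have hL0 : Tbar.topLength ^ (1 / p) ≠ 0 := by
    have : Tbar.topLength ≠ 0 := by
      simp [WalshModel.Tree.topLength, WalshModel.length_pos]
    have hp0 : 0 < p := by linarith
    simp [this, hp0.le]
  have hLt : Tbar.topLength ^ (1 / p) ≠ ⊤ :=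
    ENNReal.rpow_ne_top_of_nonneg (by positivity) ENNReal.ofReal_ne_top
  by_cases htop : WalshModel.size Tbar.bitiles f = ⊤
  · rw [htop, ENNReal.mul_top (by simp), ENNReal.top_mul hL0]
    exact le_top
  · refine le_trans ?_ (mul_le_mul_left (mul_le_mul_left
      (show (C : ℝ≥0∞) ≤ ((C + 1 : ℝ≥0) : ℝ≥0∞) by simp) _) _)
    -- The size may vanish, so it is approximated by positive numbers.
    have key : ∀ ε : ℝ, 0 < ε → _ := fun ε hε => hC f hf T Tbar hsub hconv hT
      ((WalshModel.size Tbar.bitiles f).toReal + ε)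
      (add_pos_of_nonneg_of_pos ENNReal.toReal_nonneg hε) (by
        rw [ENNReal.ofReal_add ENNReal.toReal_nonneg hε.le, ENNReal.ofReal_toReal htop]
        exact le_self_add)
    refine ge_of_tendsto (f := fun ε : ℝ => (C : ℝ≥0∞) *
      ENNReal.ofReal ((WalshModel.size Tbar.bitiles f).toReal + ε) * Tbar.topLength ^ (1 / p))
      (x := nhdsWithin 0 (Ioi 0)) ?_ ?_
    · have h1 : Filter.Tendsto (fun ε : ℝ =>
          ENNReal.ofReal ((WalshModel.size Tbar.bitiles f).toReal + ε)) (nhdsWithin 0 (Ioi 0))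
          (nhds (WalshModel.size Tbar.bitiles f)) := by
        have h2 : Filter.Tendsto (fun ε : ℝ =>
            ENNReal.ofReal ((WalshModel.size Tbar.bitiles f).toReal + ε)) (nhds 0)
            (nhds (ENNReal.ofReal ((WalshModel.size Tbar.bitiles f).toReal + 0))) :=
          (ENNReal.continuous_ofReal.comp (continuous_const.add continuous_id)).tendsto 0
        rw [add_zero, ENNReal.ofReal_toReal htop] at h2
        exact h2.mono_left nhdsWithin_le_nhds
      exact ENNReal.Tendsto.mul_const (ENNReal.Tendsto.const_mul h1 (Or.inr ENNReal.coe_ne_top))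
        (Or.inr hLt)
    · filter_upwards [self_mem_nhdsWithin] with ε hε
      exact key ε hε
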